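/- Let $(\mathcal V,\otimes,\mathbf 1,\sigma)$ be a braided monoidal category in which every object $V$ has a dual $V^*$, with $\mathrm{ev}_V:V^*\otimes V\to\mathbf 1$ and $\mathrm{coev}_V:\mathbf 1\to V\otimes V^*$, and let $(H,m,u,\Delta,\epsilon,S)$ be a Hopf algebra in $\mathcal V$. (Associativity and unit isomorphisms are suppressed.) Let $\mathcal C={}_H\mathcal V$ be the category of left $H$-modules in $\mathcal V$, with tensor product action $\rho_{X\otimes Y}=(\rho_X\otimes\rho_Y)(\mathrm{id}_H\otimes\sigma_{H,X}\otimes\mathrm{id}_Y)(\Delta\otimes\mathrm{id}_{X\otimes Y})$, unit $\mathbf 1$ with action $\epsilon$, and duals $X^*$ with $\rho_{X^*}=(\mathrm{ev}_X\otimes\mathrm{id})(\mathrm{id}\otimes\rho_X\otimes\mathrm{id})(\sigma_{H,X^*}(S\otimes\mathrm{id})\otimes\mathrm{coev}_X)$. For $V\in\mathcal V$ let $G(V)\in\mathcal Z(\mathcal C)$ be the trivial module on $V$ (action $\epsilon\otimes\mathrm{id}_V$) with half-braiding $\sigma^{-1}_{X,V}:V\otimes X\to X\otimes V$; this is a monoidal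 functor $G:\mathcal V\to\mathcal Z(\mathcal C)$. Write $V\triangleright X=G(V)\otimes X$. *Internal Hom.* Put $\underline{\mathrm{Hom}}(M,N)=N\otimes M^*$, with the adjunction $\psi:\mathrm{Hom}_{\mathcal C}(X\otimes M,N)\cong\mathrm{Hom}_{\mathcal C}(X,\underline{\mathrm{Hom}}(M,N))$, evaluation $\underline{\mathrm{ev}}_{M,N}=\psi^{-1}(\mathrm{id})$, composition $\underline{\mathrm{comp}}$, and the morphisms $\mathfrak a^{-1}_{X,M,N}=\psi(\mathrm{id}_X\otimes\underline{\mathrm{ev}}_{M,N}):X\otimes\underline{\mathrm{Hom}}(M,N)\to\underline{\mathrm{Hom}}(M,X\otimes N)$ and $\mathfrak b_{X,M,N}=\psi(\underline{\mathrm{ev}}_{X\otimes M,N}):\underline{\mathrm{Hom}}(X\otimes M,N)\otimes X\to\underline{\mathrm{Hom}}(M,N)$. The prebalancing $\beta^V_{M,N}:\underline{\mathrm{Hom}}(M,V\triangleright N)\to\underline{\mathrm{Hom}}(V^*\triangleright M,N)$ is the image under $\psi$ of $$E\otimes V^*\otimes M\xrightarrow{\ \tau^{-1}\otimes\mathrm{id}_M\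 }V^*\otimes E\otimes M\xrightarrow{\ \mathrm{id}\otimes\underline{\mathrm{ev}}\ }V^*\otimes V\otimes N\xrightarrow{\ \mathrm{ev}_V\otimes\mathrm{id}_N\ }N,$$ where $E=\underline{\mathrm{Hom}}(M,V\triangleright N)$ and $\tau:V^*\otimes E\to E\otimes V^*$ is the half-braiding of $G(V^*)$. *Relative end.* A family $\pi_M:E\to\underline{\mathrm{Hom}}(M,M)$, $M\in\mathcal C$, satisfies the relative end condition if $$\underline{\mathrm{Hom}}(\mathrm{ev}_V\triangleright\mathrm{id}_M,\mathrm{id}_M)\,\pi_M=\beta^V_{V\triangleright M,M}\,\pi_{V\triangleright M}\qquad(V\in\mathcal V,\ M\in\mathcal C),$$ where $(V^*\otimes V)\triangleright M$ is identified with $V^*\triangleright(V\triangleright M)$; a dinatural family with this property is the relative end of $(\underline{\mathrm{Hom}},\beta)$ if it is universal among such families. The algebra $A_{\mathcal V,\mathcal C}$ is the relative end $(A,\pi)$, regarded as an algebra in $\mathcal Z(\mathcal C)$, lying in the relative center (that is, $\tau^V_A\,\sigma^A_{G(V)}=\mathrm{id}$ for all $V\in\mathcal V$, where $\tau^V$ is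 the half-braiding of $G(V)$), through the half-braiding $\sigma^A$, multiplication and unit determined by $$\mathfrak a^{-1}_{X,M,M}(\mathrm{id}_X\otimes\pi_M)\,\sigma^A_X=\mathfrak b_{X,M,X\otimes M}(\pi_{X\otimes M}\otimes\mathrm{id}_X),\qquad\pi_M\circ\mathrm{mult}=\underline{\mathrm{comp}}_{M,M,M}(\pi_M\otimes\pi_M),\qquad\pi_M\circ\mathrm{unit}=\psi(\mathrm{id}_M).$$ *Braided adjoint algebra.* Let $H_{\rm ad}$ be the object $H$ with action $\rho^{\rm ad}=m(m\otimes\mathrm{id})(\mathrm{id}_{H\otimes H}\otimes S)(\mathrm{id}_H\otimes\sigma_{H,H})(\Delta\otimes\mathrm{id}_H)$; this is an object of $\mathcal C$. Then the following hold. 1. For every $(X,\rho_X)\in\mathcal C$ the morphism $\pi_X=(\rho_X\otimes\mathrm{id}_{X^*})(\mathrm{id}_H\otimes\mathrm{coev}_X):H_{\rm ad}\to X\otimes X^*=\underline{\mathrm{Hom}}(X,X)$ is a morphism in $\mathcal C$. The family $\pi$ is dinatural and satisfies the relative end condition. 2. The morphisms $\gamma_X=(\rho_X\otimes\mathrm{id}_H)(\mathrm{id}_H\otimes\sigma_{H,X})(\Delta\otimes\mathrm{id}_X):H_{\rm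 ad}\otimes X\to X\otimes H_{\rm ad}$ are isomorphisms in $\mathcal C$ and form a half-braiding on $H_{\rm ad}$, and $m$, $u$ make $(H_{\rm ad},\gamma)$ an algebra in $\mathcal Z(\mathcal C)$. With the family $\pi$ it is a realization of $A_{\mathcal V,\mathcal C}$ (in particular the relative end exists and $(H_{\rm ad},\gamma)$ lies in the relative center). For every realization $(A,\xi)$ of $A_{\mathcal V,\mathcal C}$ there is an isomorphism of algebras $e:A\cong H_{\rm ad}$ in $\mathcal Z(\mathcal C)$ with $\pi_X\,e=\xi_X$ for all $X\in\mathcal C$. -/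

import Mathlib

open CategoryTheory MonoidalCategory
open scoped MonObj ComonObj

universe v u

namespace BraidedAdjoint

section Modules

variable {V : Type u} [Category.{v} V] [MonoidalCategory V]

/-- The action `H ⊗ M ⟶ M` of a module object `M` in `V` over `H`. -/
def act {H : V} [MonObj H] (M : Mod V H) : H ⊗ M.X ⟶ M.X := M.mod.smul

lemma one_act {H : V} [MonObj H] (M : Mod V H) : η[H] ▷ M.X ≫ act M = (λ_ M.X).hom :=
  M.mod.one_smul

lemma mul_act {H : V} [MonObj H] (M : Mod V H) :
    μ[H] ▷ M.X ≫ act M = (α_ H H M.X).hom ≫ H ◁ act M ≫ act M :=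
  M.mod.mul_smul

lemma act_hom {H : V} [MonObj H] {M N : Mod V H} (f : M ⟶ N) :
    act M ≫ f.hom = H ◁ f.hom ≫ act N :=
  f.isModHom.smul_hom

/-- The module object with a given underlying object and action. -/
def mkMod {H : V} [MonObj H] (X : V) (a : H ⊗ X ⟶ X)
    (one_act : η[H] ▷ X ≫ a = (λ_ X).hom)
    (mul_act : μ[H] ▷ X ≫ a = (α_ H H X).hom ≫ H ◁ a ≫ a) : Mod V H where
  X := X
  mod := { smul := a, one_smul := one_act, mul_smul := mul_act }

/-- The morphism of module objects with a given underlying morphism. -/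
def mkHom {H : V} [MonObj H] {M N : Mod V H} (f : M.X ⟶ N.X)
    (h : act M ≫ f = H ◁ f ≫ act N) : M ⟶ N :=
  Mod.Hom.mk' f h

/-- The isomorphism of module objects with a given underlying isomorphism. -/
def mkIso {H : V} [MonObj H] {M N : Mod V H} (e : M.X ≅ N.X)
    (h : act M ≫ e.hom = H ◁ e.hom ≫ act N) : M ≅ N where
  hom := mkHom e.hom h
  inv := mkHom e.inv (by
    rw [← cancel_mono e.hom, Category.assoc, Category.assoc, h, e.inv_hom_id, Category.comp_id,
      ← MonoidalCategory.whiskerLeft_comp_assoc, e.inv_hom_id, MonoidalCategory.whiskerLeft_id,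
      Category.id_comp])
  hom_inv_id := Mod.hom_ext _ _ e.hom_inv_id
  inv_hom_id := Mod.hom_ext _ _ e.inv_hom_id

lemma comp_id_eq {H Z : V} {a b : H ⊗ Z ⟶ Z} (h : a = b) : a ≫ 𝟙 Z = H ◁ 𝟙 Z ≫ b := by
  rw [h, MonoidalCategory.whiskerLeft_id, Category.comp_id, Category.id_comp]

variable [BraidedCategory V]

/-- The trivial module on an object `X`: the action is `ε ⊗ id`. -/
def triv (H : V) [BimonObj H] (X : V) : Mod V H :=
  mkMod X (ε[H] ▷ X ≫ (λ_ X).hom)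
    (by rw [← comp_whiskerRight_assoc, BimonObj.one_counit, id_whiskerRight, Category.id_comp])
    (by
      rw [← comp_whiskerRight_assoc, Bimon.mul_counit, MonoidalCategory.tensorHom_def_assoc,
        MonoidalCategory.whiskerLeft_comp, Category.assoc, whisker_exchange_assoc]
      rw [whisker_exchange_assoc]
      monoidal)

/-- The tensor product of two modules: the action is
`(ρ_M ⊗ ρ_N) (id_H ⊗ σ_{H,M} ⊗ id_N) (Δ ⊗ id_{M ⊗ N})`. -/
def tensorMod {H : V} [BimonObj H] (M N : Mod V H) : Mod V H :=
  mkMod (M.X ⊗ N.X) (Δ[H] ▷ (M.X ⊗ N.X) ≫ tensorμ H H M.X N.X ≫ (act M ⊗ₘ act N))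
    (by
      rw [← comp_whiskerRight_assoc, Bimon.one_comul, comp_whiskerRight_assoc,
        tensorμ_natural_left_assoc, tensorHom_comp_tensorHom, one_act, one_act]
      rw [tensor_left_unitality, leftUnitor_inv_whiskerRight])
    (by
      have e1 := tensor_associativity H H H H M.X N.X
      have e2 := tensorμ_natural_right H H (act M) (act N)
      rw [← comp_whiskerRight_assoc, BimonObj.mul_comul, comp_whiskerRight_assoc,
        comp_whiskerRight_assoc, tensorμ_natural_left_assoc, tensorHom_comp_tensorHom, mul_act,
        mul_act, ← tensorHom_comp_tensorHom, ← tensorHom_comp_tensorHom, reassoc_of% e1,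
        ← reassoc_of% e2, MonoidalCategory.whiskerLeft_comp, MonoidalCategory.whiskerLeft_comp]
      simp only [Category.assoc, whisker_exchange_assoc, MonoidalCategory.tensorHom_def,
        comp_whiskerRight]
      monoidal)

lemma tensor_act_hom {H : V} [BimonObj H] {M M' N N' : Mod V H} (f : M ⟶ M') (g : N ⟶ N') :
    act (tensorMod M N) ≫ (f.hom ⊗ₘ g.hom) = H ◁ (f.hom ⊗ₘ g.hom) ≫ act (tensorMod M' N') := by
  change (Δ[H] ▷ (M.X ⊗ N.X) ≫ tensorμ H H M.X N.X ≫ (act M ⊗ₘ act N)) ≫ (f.hom ⊗ₘ g.hom) =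
    H ◁ (f.hom ⊗ₘ g.hom) ≫ Δ[H] ▷ (M'.X ⊗ N'.X) ≫ tensorμ H H M'.X N'.X ≫ (act M' ⊗ₘ act N')
  have e := tensorμ_natural_right H H f.hom g.hom
  rw [whisker_exchange_assoc, reassoc_of% e, Category.assoc, Category.assoc,
    tensorHom_comp_tensorHom, tensorHom_comp_tensorHom, act_hom, act_hom]

/-- The left modules over a bimonoid form a monoidal category; the underlying object of a tensor
product is the tensor product of the underlying objects. -/
instance instMonoidalStruct (H : V) [BimonObj H] : MonoidalCategoryStruct (Mod V H) where
  tensorObj M N := tensorMod M N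
  tensorHom f g := mkHom (f.hom ⊗ₘ g.hom) (tensor_act_hom f g)
  whiskerLeft M {_ _} f := mkHom (M.X ◁ f.hom) (by
    have e := tensor_act_hom (𝟙 M) f
    rwa [Mod.id_hom', id_tensorHom] at e)
  whiskerRight {_ _} f N := mkHom (f.hom ▷ N.X) (by
    have e := tensor_act_hom f (𝟙 N)
    rwa [Mod.id_hom', tensorHom_id] at e)
  tensorUnit := triv H (𝟙_ V)
  associator M N P := mkIso (α_ M.X N.X P.X) (by
    have e := associator_monoidal H H H M.X N.X P.X
    change (Δ[H] ▷ ((M.X ⊗ N.X) ⊗ P.X) ≫ tensorμ H H (M.X ⊗ N.X) P.X ≫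
      ((Δ[H] ▷ (M.X ⊗ N.X) ≫ tensorμ H H M.X N.X ≫ (act M ⊗ₘ act N)) ⊗ₘ act P)) ≫
        (α_ M.X N.X P.X).hom = H ◁ (α_ M.X N.X P.X).hom ≫
      Δ[H] ▷ (M.X ⊗ N.X ⊗ P.X) ≫ tensorμ H H M.X (N.X ⊗ P.X) ≫
        (act M ⊗ₘ (Δ[H] ▷ (N.X ⊗ P.X) ≫ tensorμ H H N.X P.X ≫ (act N ⊗ₘ act P)))
    have e1 : (act M ⊗ₘ (Δ[H] ▷ (N.X ⊗ P.X) ≫ tensorμ H H N.X P.X ≫ (act N ⊗ₘ act P))) =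
        (H ⊗ M.X) ◁ Δ[H] ▷ (N.X ⊗ P.X) ≫ (H ⊗ M.X) ◁ tensorμ H H N.X P.X ≫
          (act M ⊗ₘ (act N ⊗ₘ act P)) := by
      simp only [← id_tensorHom, tensorHom_comp_tensorHom, Category.id_comp]
    have e2 : ((Δ[H] ▷ (M.X ⊗ N.X) ≫ tensorμ H H M.X N.X ≫ (act M ⊗ₘ act N)) ⊗ₘ act P) =
        Δ[H] ▷ (M.X ⊗ N.X) ▷ (H ⊗ P.X) ≫ tensorμ H H M.X N.X ▷ (H ⊗ P.X) ≫
          ((act M ⊗ₘ act N) ⊗ₘ act P) := by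
      simp only [← tensorHom_id, tensorHom_comp_tensorHom, Category.id_comp]
    have e3 := tensorμ_natural_left Δ[H] (𝟙 H) (M.X ⊗ N.X) P.X
    have e4 := tensorμ_natural_left (𝟙 H) Δ[H] M.X (N.X ⊗ P.X)
    have e5 := ComonObj.comul_assoc H
    simp only [id_whiskerRight, tensorHom_id, id_tensorHom] at e3 e4
    rw [e1, e2]
    simp only [Category.assoc]
    rw [associator_naturality, ← reassoc_of% e3, reassoc_of% e, ← reassoc_of% e4,
      MonoidalCategory.tensorHom_def'_assoc, ← comp_whiskerRight_assoc Δ[H] (H ◁ Δ[H]), e5]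
    simp only [comp_whiskerRight, Category.assoc, whisker_exchange_assoc])
  leftUnitor M := mkIso (λ_ M.X) (by
    change (Δ[H] ▷ (𝟙_ V ⊗ M.X) ≫ tensorμ H H (𝟙_ V) M.X ≫
      ((ε[H] ▷ 𝟙_ V ≫ (λ_ (𝟙_ V)).hom) ⊗ₘ act M)) ≫ (λ_ M.X).hom = H ◁ (λ_ M.X).hom ≫ act M

    have e := tensorμ_natural_left ε[H] (𝟙 H) (𝟙_ V) M.X
    have e1 := leftUnitor_monoidal H M.X
    have e2 : ((ε[H] ▷ 𝟙_ V ≫ (λ_ (𝟙_ V)).hom) ⊗ₘ act M) =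
        (ε[H] ▷ 𝟙_ V ⊗ₘ (𝟙 H) ▷ M.X) ≫ (λ_ (𝟙_ V)).hom ▷ (H ⊗ M.X) ≫ 𝟙_ V ◁ act M := by
      rw [← MonoidalCategory.tensorHom_def, tensorHom_comp_tensorHom, id_whiskerRight,
        Category.id_comp]
    rw [tensorHom_id] at e
    rw [e2]
    simp only [Category.assoc]
    rw [← reassoc_of% e, leftUnitor_naturality, ← reassoc_of% e1, ← comp_whiskerRight_assoc,
      ComonObj.counit_comul, MonoidalCategory.tensorHom_def]
    monoidal)
  rightUnitor M := mkIso (ρ_ M.X) (by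
    change (Δ[H] ▷ (M.X ⊗ 𝟙_ V) ≫ tensorμ H H M.X (𝟙_ V) ≫
      (act M ⊗ₘ (ε[H] ▷ 𝟙_ V ≫ (λ_ (𝟙_ V)).hom))) ≫ (ρ_ M.X).hom = H ◁ (ρ_ M.X).hom ≫ act M

    have e := tensorμ_natural_left (𝟙 H) ε[H] M.X (𝟙_ V)
    have e1 := rightUnitor_monoidal H M.X
    have e2 : (act M ⊗ₘ (ε[H] ▷ 𝟙_ V ≫ (λ_ (𝟙_ V)).hom)) =
        ((𝟙 H) ▷ M.X ⊗ₘ ε[H] ▷ 𝟙_ V) ≫ (H ⊗ M.X) ◁ (λ_ (𝟙_ V)).hom ≫ act M ▷ 𝟙_ V := by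
      rw [← MonoidalCategory.tensorHom_def', tensorHom_comp_tensorHom, id_whiskerRight,
        Category.id_comp]
    rw [id_tensorHom] at e
    rw [e2]
    simp only [Category.assoc]
    rw [← reassoc_of% e, rightUnitor_naturality, ← reassoc_of% e1, ← comp_whiskerRight_assoc,
      ComonObj.comul_counit, MonoidalCategory.tensorHom_def]
    monoidal)

instance instMonoidal (H : V) [BimonObj H] : MonoidalCategory (Mod V H)  where
  tensorHom_def f g := Mod.hom_ext _ _ (MonoidalCategory.tensorHom_def f.hom g.hom)
  id_tensorHom_id M N := Mod.hom_ext _ _ (id_tensorHom_id M.X N.X)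
  tensorHom_comp_tensorHom f g h k :=
    Mod.hom_ext _ _ (tensorHom_comp_tensorHom f.hom g.hom h.hom k.hom)
  whiskerLeft_id M N := Mod.hom_ext _ _ (MonoidalCategory.whiskerLeft_id M.X N.X)
  id_whiskerRight M N := Mod.hom_ext _ _ (id_whiskerRight M.X N.X)
  associator_naturality f g h := Mod.hom_ext _ _ (associator_naturality f.hom g.hom h.hom)
  leftUnitor_naturality f := Mod.hom_ext _ _ (leftUnitor_naturality f.hom)
  rightUnitor_naturality f := Mod.hom_ext _ _ (rightUnitor_naturality f.hom)
  pentagon M N P Q := Mod.hom_ext _ _ (pentagon M.X N.X P.X Q.X)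
  triangle M N := Mod.hom_ext _ _ (triangle M.X N.X)

end Modules

section Dual

variable {V : Type u} [Category.{v} V] [MonoidalCategory V]
variable {H X Y : V} [ExactPairing X Y]

/-- The transpose `Y ⊗ H ⟶ Y` of a morphism `H ⊗ X ⟶ X`, where `Y` is dual to `X`. -/
def transpose (Y : V) [ExactPairing X Y] (a : H ⊗ X ⟶ X) : Y ⊗ H ⟶ Y :=
  Y ◁ ((ρ_ H).inv ≫ H ◁ η_ X Y ≫ (α_ H X Y).inv ≫ a ▷ Y) ≫ (α_ Y X Y).inv ≫ ε_ X Y ▷ Y ≫ (λ_ Y).hom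

lemma ext_ev {A : V} {f g : A ⟶ Y} (h : f ▷ X ≫ ε_ X Y = g ▷ X ≫ ε_ X Y) : f = g := by
  have key : ∀ f : A ⟶ Y, f = (ρ_ A).inv ≫ A ◁ η_ X Y ≫ (α_ A X Y).inv ≫ (f ▷ X ≫ ε_ X Y) ▷ Y ≫
      (λ_ Y).hom := by
    intro f
    rw [comp_whiskerRight, Category.assoc, ← associator_inv_naturality_left_assoc,
      whisker_exchange_assoc, ExactPairing.coevaluation_evaluation_assoc]
    simp
  rw [key f, key g, h]

lemma transpose_ev (a : H ⊗ X ⟶ X) :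
    transpose Y a ▷ X ≫ ε_ X Y = (α_ Y H X).hom ≫ Y ◁ a ≫ ε_ X Y := by
  calc _ = 𝟙 _ ⊗≫ Y ◁ H ◁ η_ X Y ▷ X ⊗≫ Y ◁ a ▷ (Y ⊗ X) ⊗≫ (ε_ X Y ▷ (Y ⊗ X) ≫ 𝟙_ V ◁ ε_ X Y) ⊗≫ 𝟙 _ := by
        simp only [transpose]; monoidal
    _ = 𝟙 _ ⊗≫ Y ◁ H ◁ η_ X Y ▷ X ⊗≫ Y ◁ (a ▷ (Y ⊗ X) ≫ X ◁ ε_ X Y) ⊗≫ ε_ X Y := by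
        rw [← whisker_exchange]; monoidal
    _ = 𝟙 _ ⊗≫ Y ◁ H ◁ (η_ X Y ▷ X ⊗≫ X ◁ ε_ X Y) ⊗≫ Y ◁ a ⊗≫ ε_ X Y := by
        rw [← whisker_exchange]; monoidal
    _ = _ := by rw [ExactPairing.evaluation_coevaluation'']; monoidal

lemma transpose_coev (a : H ⊗ X ⟶ X) :
    η_ X Y ▷ H ≫ (α_ X Y H).hom ≫ X ◁ transpose Y a =
      (λ_ H).hom ≫ (ρ_ H).inv ≫ H ◁ η_ X Y ≫ (α_ H X Y).inv ≫ a ▷ Y := by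
  calc _ = 𝟙 _ ⊗≫ (η_ X Y ▷ (H ⊗ 𝟙_ V) ≫ (X ⊗ Y) ◁ (H ◁ η_ X Y)) ⊗≫ X ◁ Y ◁ a ▷ Y ⊗≫ X ◁ ε_ X Y ▷ Y ⊗≫ 𝟙 _ := by
        simp only [transpose]; monoidal
    _ = 𝟙 _ ⊗≫ H ◁ η_ X Y ⊗≫ (η_ X Y ▷ (H ⊗ X) ≫ (X ⊗ Y) ◁ a) ▷ Y ⊗≫ X ◁ ε_ X Y ▷ Y ⊗≫ 𝟙 _ := by
        rw [← whisker_exchange]; monoidal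
    _ = 𝟙 _ ⊗≫ H ◁ η_ X Y ⊗≫ a ▷ Y ⊗≫ (η_ X Y ▷ X ⊗≫ X ◁ ε_ X Y) ▷ Y ⊗≫ 𝟙 _ := by
        rw [← whisker_exchange]; monoidal
    _ = _ := by rw [ExactPairing.evaluation_coevaluation'']; monoidal
end Dual

section DualMod

variable {V : Type u} [Category.{v} V] [MonoidalCategory V] [BraidedCategory V]
variable {H : V} [HopfObj H]

/-- The action on the dual `Y = M^*` of a module:
`(ev_M ⊗ id) (id ⊗ ρ_M ⊗ id) (σ_{H,Y} (S ⊗ id) ⊗ coev_M)`. -/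
def dualAct (M : Mod V H) (Y : V) [ExactPairing M.X Y] : H ⊗ Y ⟶ Y :=
  HopfObj.antipode ▷ Y ≫ (β_ H Y).hom ≫ transpose Y (act M)

lemma dualAct_ev (M : Mod V H) (Y : V) [ExactPairing M.X Y] :
    dualAct M Y ▷ M.X ≫ ε_ M.X Y = HopfObj.antipode ▷ Y ▷ M.X ≫ (β_ H Y).hom ▷ M.X ≫
      (α_ Y H M.X).hom ≫ Y ◁ act M ≫ ε_ M.X Y := by
  simp only [dualAct, comp_whiskerRight, Category.assoc, transpose_ev]

lemma transpose_mul (M : Mod V H) (Y : V) [ExactPairing M.X Y] :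
    Y ◁ μ[H] ≫ transpose Y (act M) =
      (α_ Y H H).inv ≫ transpose Y (act M) ▷ H ≫ transpose Y (act M) := by
  apply ext_ev (X := M.X)
  have e := mul_act M
  rw [comp_whiskerRight, comp_whiskerRight, comp_whiskerRight, Category.assoc, Category.assoc,
    Category.assoc, transpose_ev, associator_naturality_middle_assoc,
    ← MonoidalCategory.whiskerLeft_comp_assoc, e, associator_naturality_left_assoc,
    ← whisker_exchange_assoc, transpose_ev]
  monoidal

/-- The dual of a module `M`; its underlying object is a dual `Y` of that of `M`. -/
def dualMod (M : Mod V H) (Y : V) [ExactPairing M.X Y] : Mod V H :=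
  mkMod Y (dualAct M Y)
    (by
      apply ext_ev (X := M.X)
      rw [comp_whiskerRight, Category.assoc, dualAct_ev, ← comp_whiskerRight_assoc,
        ← comp_whiskerRight, HopfObj.one_antipode, ← comp_whiskerRight_assoc,
        BraidedCategory.braiding_naturality_left, comp_whiskerRight_assoc,
        associator_naturality_middle_assoc, ← MonoidalCategory.whiskerLeft_comp_assoc, one_act]
      simp)
    (by
      have e : (β_ H H).hom ▷ Y ≫ (β_ (H ⊗ H) Y).hom ≫ (α_ Y H H).inv =
          (α_ H H Y).hom ≫ H ◁ (β_ H Y).hom ≫ (β_ H (Y ⊗ H)).hom := by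
        rw [BraidedCategory.braiding_naturality_right, BraidedCategory.braiding_tensor_left_hom,
          BraidedCategory.braiding_tensor_right_hom]
        monoidal
      have e1 : H ◁ dualAct M Y ≫ dualAct M Y =
          (HopfObj.antipode ⊗ₘ (HopfObj.antipode ▷ Y)) ≫
            H ◁ (β_ H Y).hom ≫ (β_ H (Y ⊗ H)).hom ≫ transpose Y (act M) ▷ H ≫
              transpose Y (act M) := by
        simp only [dualAct, MonoidalCategory.whiskerLeft_comp, Category.assoc]
        rw [whisker_exchange_assoc, BraidedCategory.braiding_naturality_right_assoc,
          whisker_exchange_assoc, MonoidalCategory.tensorHom_def'_assoc]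
      have e2 : (α_ H H Y).hom ≫ (HopfObj.antipode ⊗ₘ (HopfObj.antipode (X := H) ▷ Y)) =
          (HopfObj.antipode (X := H) ⊗ₘ HopfObj.antipode (X := H)) ▷ Y ≫ (α_ H H Y).hom := by
        rw [← tensorHom_id, ← tensorHom_id, associator_naturality]
      rw [e1, reassoc_of% e2, ← reassoc_of% e, dualAct, ← comp_whiskerRight_assoc,
        HopfObj.mul_antipode]
      simp only [comp_whiskerRight, Category.assoc,
        BraidedCategory.braiding_naturality_left_assoc, transpose_mul])

lemma dual_ev (M : Mod V H) (Y : V) [ExactPairing M.X Y] :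
    act (dualMod M Y ⊗ M) ≫ ε_ M.X Y = H ◁ ε_ M.X Y ≫ act (𝟙_ (Mod V H)) := by
  change (Δ[H] ▷ (Y ⊗ M.X) ≫ tensorμ H H Y M.X ≫ (dualAct M Y ⊗ₘ act M)) ≫ ε_ M.X Y =
    H ◁ ε_ M.X Y ≫ ε[H] ▷ 𝟙_ V ≫ (λ_ (𝟙_ V)).hom
  calc _ = 𝟙 _ ⊗≫ Δ[H] ▷ (Y ⊗ M.X) ⊗≫ H ◁ (β_ H Y).hom ▷ M.X ⊗≫
        ((H ⊗ Y) ◁ act M ≫ HopfObj.antipode ▷ Y ▷ M.X) ≫ (β_ H Y).hom ▷ M.X ⊗≫ Y ◁ act M ≫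
          ε_ M.X Y := by
        rw [MonoidalCategory.tensorHom_def']
        simp only [Category.assoc, dualAct_ev, tensorμ]
        monoidal
    _ = 𝟙 _ ⊗≫ Δ[H] ▷ (Y ⊗ M.X) ⊗≫ (H ◁ (β_ H Y).hom ≫ HopfObj.antipode ▷ (Y ⊗ H)) ▷ M.X ⊗≫
        ((H ⊗ Y) ◁ act M ≫ (β_ H Y).hom ▷ M.X) ⊗≫ Y ◁ act M ≫ ε_ M.X Y := by
        rw [whisker_exchange]; monoidal
    _ = 𝟙 _ ⊗≫ (Δ[H] ≫ HopfObj.antipode ▷ H) ▷ (Y ⊗ M.X) ⊗≫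
        (H ◁ (β_ H Y).hom ⊗≫ (β_ H Y).hom ▷ H) ▷ M.X ⊗≫
          Y ◁ ((α_ H H M.X).hom ≫ H ◁ act M ≫ act M) ≫ ε_ M.X Y := by
        rw [whisker_exchange, whisker_exchange]; monoidal
    _ = 𝟙 _ ⊗≫ (Δ[H] ≫ HopfObj.antipode ▷ H) ▷ (Y ⊗ M.X) ⊗≫
        ((β_ (H ⊗ H) Y).hom ≫ Y ◁ μ[H]) ▷ M.X ⊗≫ Y ◁ act M ≫ ε_ M.X Y := by
        rw [← mul_act, BraidedCategory.braiding_tensor_left_hom]; monoidal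
    _ = 𝟙 _ ⊗≫ ((Δ[H] ≫ HopfObj.antipode ▷ H ≫ μ[H]) ▷ Y ≫ (β_ H Y).hom) ▷ M.X ⊗≫
          Y ◁ act M ≫ ε_ M.X Y := by
        rw [← BraidedCategory.braiding_naturality_left]; monoidal
    _ = 𝟙 _ ⊗≫ ε[H] ▷ (Y ⊗ M.X) ⊗≫ (β_ (𝟙_ V) Y).hom ▷ M.X ⊗≫ Y ◁ (η[H] ▷ M.X ≫ act M) ≫
          ε_ M.X Y := by
        rw [HopfObj.antipode_left, comp_whiskerRight ε[H] η[H] Y, Category.assoc,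
          BraidedCategory.braiding_naturality_left]
        monoidal
    _ = 𝟙 _ ⊗≫ (ε[H] ▷ (Y ⊗ M.X) ≫ 𝟙_ V ◁ ε_ M.X Y) ⊗≫ 𝟙 _ := by
        rw [one_act, braiding_tensorUnit_left]; monoidal
    _ = _ := by
        rw [← whisker_exchange]; monoidal

lemma dual_coev (M : Mod V H) (Y : V) [ExactPairing M.X Y] :
    act (𝟙_ (Mod V H)) ≫ η_ M.X Y = H ◁ η_ M.X Y ≫ act (M ⊗ dualMod M Y) := by
  change (ε[H] ▷ 𝟙_ V ≫ (λ_ (𝟙_ V)).hom) ≫ η_ M.X Y =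
    H ◁ η_ M.X Y ≫ Δ[H] ▷ (M.X ⊗ Y) ≫ tensorμ H H M.X Y ≫ (act M ⊗ₘ dualAct M Y)
  have e : (ρ_ H).hom ≫ (λ_ H).inv ≫ η_ M.X Y ▷ H ≫ (α_ M.X Y H).hom =
      H ◁ η_ M.X Y ≫ (α_ H M.X Y).inv ≫ (β_ H M.X).hom ▷ Y ≫ (α_ M.X H Y).hom ≫
        M.X ◁ (β_ H Y).hom := by
    have e0 := BraidedCategory.braiding_naturality_right H (η_ M.X Y)
    rw [braiding_tensorUnit_right, BraidedCategory.braiding_tensor_right_hom] at e0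
    rw [← cancel_mono (α_ M.X Y H).inv]
    simpa using e0.symm
  symm
  calc _ = 𝟙 _ ⊗≫ Δ[H] ▷ 𝟙_ V ⊗≫ H ◁ (H ◁ η_ M.X Y ⊗≫
        ((β_ H M.X).hom ▷ Y ⊗≫ M.X ◁ HopfObj.antipode (X := H) ▷ Y) ⊗≫
          M.X ◁ (β_ H Y).hom ≫ M.X ◁ transpose Y (act M)) ⊗≫ act M ▷ Y := by
        rw [MonoidalCategory.tensorHom_def', whisker_exchange_assoc, dualAct]
        simp only [tensorμ]
        monoidal
    _ = 𝟙 _ ⊗≫ Δ[H] ▷ 𝟙_ V ⊗≫ H ◁ (H ◁ η_ M.X Y ⊗≫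
        ((β_ H M.X).hom ≫ M.X ◁ HopfObj.antipode) ▷ Y ⊗≫
          M.X ◁ (β_ H Y).hom ≫ M.X ◁ transpose Y (act M)) ⊗≫ act M ▷ Y := by
        monoidal
    _ = 𝟙 _ ⊗≫ Δ[H] ▷ 𝟙_ V ⊗≫ H ◁ ((H ◁ η_ M.X Y ≫ HopfObj.antipode ▷ (M.X ⊗ Y)) ⊗≫
        (β_ H M.X).hom ▷ Y ⊗≫
          M.X ◁ (β_ H Y).hom ≫ M.X ◁ transpose Y (act M)) ⊗≫ act M ▷ Y := by
        rw [← BraidedCategory.braiding_naturality_left]; monoidal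
    _ = 𝟙 _ ⊗≫ (Δ[H] ≫ H ◁ HopfObj.antipode) ⊗≫ H ◁ ((H ◁ η_ M.X Y ≫ (α_ H M.X Y).inv ≫
        (β_ H M.X).hom ▷ Y ≫ (α_ M.X H Y).hom ≫ M.X ◁ (β_ H Y).hom) ≫
          M.X ◁ transpose Y (act M)) ⊗≫ act M ▷ Y := by
        rw [whisker_exchange]; monoidal
    _ = 𝟙 _ ⊗≫ (Δ[H] ≫ H ◁ HopfObj.antipode) ⊗≫ H ◁ H ◁ η_ M.X Y ⊗≫
        ((α_ H H M.X).hom ≫ H ◁ act M ≫ act M) ▷ Y := by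
        rw [← e]
        simp only [Category.assoc, transpose_coev]
        monoidal
    _ = 𝟙 _ ⊗≫ (Δ[H] ≫ H ◁ HopfObj.antipode) ⊗≫ ((H ⊗ H) ◁ η_ M.X Y ≫ μ[H] ▷ (M.X ⊗ Y)) ⊗≫
        act M ▷ Y := by
        rw [← mul_act]; monoidal
    _ = 𝟙 _ ⊗≫ (Δ[H] ≫ H ◁ HopfObj.antipode ≫ μ[H]) ⊗≫ H ◁ η_ M.X Y ⊗≫ act M ▷ Y := by
        rw [whisker_exchange]; monoidal
    _ = 𝟙 _ ⊗≫ ε[H] ⊗≫ (η[H] ▷ 𝟙_ V ≫ H ◁ η_ M.X Y) ⊗≫ act M ▷ Y := by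
        rw [HopfObj.antipode_right]; monoidal
    _ = 𝟙 _ ⊗≫ ε[H] ⊗≫ η_ M.X Y ⊗≫ (η[H] ▷ M.X ≫ act M) ▷ Y := by
        rw [← whisker_exchange]; monoidal
    _ = _ := by
        rw [one_act]; monoidal

instance (M : Mod V H) (Y : V) [ExactPairing M.X Y] : ExactPairing M (dualMod M Y) where
  coevaluation' := mkHom (η_ M.X Y) (dual_coev M Y)
  evaluation' := mkHom (ε_ M.X Y) (dual_ev M Y)
  coevaluation_evaluation' := Mod.hom_ext _ _ (ExactPairing.coevaluation_evaluation M.X Y)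
  evaluation_coevaluation' := Mod.hom_ext _ _ (ExactPairing.evaluation_coevaluation M.X Y)

/-- Duals of modules are computed in `V`, with the evaluation and coevaluation of `V`. -/
noncomputable instance [RightRigidCategory V] : RightRigidCategory (Mod V H) where
  rightDual M := { rightDual := dualMod M M.Xᘁ, exact := inferInstance }

end DualMod

section Triv
variable {V : Type u} [Category.{v} V] [MonoidalCategory V] [BraidedCategory V]
variable {H : V} [BimonObj H]

lemma act_triv_tensor (X : V) (M : Mod V H) : act (triv H X ⊗ M) =
    (α_ H X M.X).inv ≫ (β_ H X).hom ▷ M.X ≫ (α_ X H M.X).hom ≫ X ◁ act M := by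
  change Δ[H] ▷ (X ⊗ M.X) ≫ tensorμ H H X M.X ≫ ((ε[H] ▷ X ≫ (λ_ X).hom) ⊗ₘ act M) = _
  calc _ = 𝟙 _ ⊗≫ Δ[H] ▷ (X ⊗ M.X) ⊗≫ (H ◁ ((β_ H X).hom ▷ M.X) ≫ ε[H] ▷ ((X ⊗ H) ⊗ M.X)) ⊗≫
        X ◁ act M := by
        rw [MonoidalCategory.tensorHom_def]
        simp only [tensorμ]
        monoidal
    _ = 𝟙 _ ⊗≫ (Δ[H] ≫ ε[H] ▷ H) ▷ (X ⊗ M.X) ⊗≫ (β_ H X).hom ▷ M.X ⊗≫ X ◁ act M := by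
        rw [whisker_exchange]; monoidal
    _ = _ := by
        rw [ComonObj.counit_comul]; monoidal

lemma act_tensor_triv (M : Mod V H) (X : V) : act (M ⊗ triv H X) =
    (α_ H M.X X).inv ≫ act M ▷ X := by
  change Δ[H] ▷ (M.X ⊗ X) ≫ tensorμ H H M.X X ≫ (act M ⊗ₘ (ε[H] ▷ X ≫ (λ_ X).hom)) = _
  calc _ = 𝟙 _ ⊗≫ Δ[H] ▷ (M.X ⊗ X) ⊗≫ H ◁ ((β_ H M.X).hom ≫ M.X ◁ ε[H]) ▷ X ⊗≫
        act M ▷ X := by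
        rw [MonoidalCategory.tensorHom_def']
        simp only [tensorμ]
        monoidal
    _ = 𝟙 _ ⊗≫ (Δ[H] ≫ H ◁ ε[H]) ▷ (M.X ⊗ X) ⊗≫ H ◁ (β_ (𝟙_ V) M.X).hom ▷ X ⊗≫ act M ▷ X := by
        rw [← BraidedCategory.braiding_naturality_left]; monoidal
    _ = _ := by
        rw [ComonObj.comul_counit, braiding_tensorUnit_left]; monoidal

/-- The half-braiding `σ_{M,X}⁻¹ : X ⊗ M ⟶ M ⊗ X` on a trivial module. -/
def trivBraiding (X : V) (M : Mod V H) : triv H X ⊗ M ≅ M ⊗ triv H X :=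
  (mkIso (M := M ⊗ triv H X) (N := triv H X ⊗ M) (β_ M.X X) (by
    rw [act_triv_tensor, act_tensor_triv]
    change ((α_ H M.X X).inv ≫ act M ▷ X) ≫ (β_ M.X X).hom = H ◁ (β_ M.X X).hom ≫
      (α_ H X M.X).inv ≫ (β_ H X).hom ▷ M.X ≫ (α_ X H M.X).hom ≫ X ◁ act M
    rw [Category.assoc, BraidedCategory.braiding_naturality_left,
      BraidedCategory.braiding_tensor_left_hom]
    simp)).symm

variable (H)

/-- A trivial module as an object of the center. -/
def trivCenterObj (X : V) : Center (Mod V H) :=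
  ⟨triv H X,
    { β := fun M => trivBraiding X M
      monoidal := fun M N => Mod.hom_ext _ _ (by
        change (β_ (M.X ⊗ N.X) X).inv = (α_ X M.X N.X).inv ≫ (β_ M.X X).inv ▷ N.X ≫
          (α_ M.X X N.X).hom ≫ M.X ◁ (β_ N.X X).inv ≫ (α_ M.X N.X X).inv
        rw [BraidedCategory.braiding_tensor_left_inv]
        )
      naturality := fun {M N} f => Mod.hom_ext _ _ (by
        change X ◁ f.hom ≫ (β_ N.X X).inv = (β_ M.X X).inv ≫ f.hom ▷ X
        exact BraidedCategory.braiding_inv_naturality_right X f.hom) }⟩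

/-- The functor sending an object `X` to the trivial module on `X`
with the half-braiding `σ_{-,X}⁻¹`. -/
def centralFunctor : V ⥤ Center (Mod V H) where
  obj X := trivCenterObj H X
  map {X Y} f :=
    { f := mkHom (M := triv H X) (N := triv H Y) f (by
        change (ε[H] ▷ X ≫ (λ_ X).hom) ≫ f = H ◁ f ≫ ε[H] ▷ Y ≫ (λ_ Y).hom
        rw [whisker_exchange_assoc, leftUnitor_naturality, Category.assoc])
      comm := fun M => Mod.hom_ext _ _ (by
        change f ▷ M.X ≫ (β_ M.X Y).inv = (β_ M.X X).inv ≫ M.X ◁ f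
        exact BraidedCategory.braiding_inv_naturality_left f M.X) }
  map_id X := rfl
  map_comp f g := rfl

/-- The unit constraint, whose underlying morphism is an identity. -/
def centralUnitIso : 𝟙_ (Center (Mod V H)) ≅ (centralFunctor H).obj (𝟙_ V) where
  hom :=
    { f := 𝟙 (triv H (𝟙_ V))
      comm := fun M => Mod.hom_ext _ _ (by
        change 𝟙 (𝟙_ V) ▷ M.X ≫ (β_ M.X (𝟙_ V)).inv =
          ((λ_ M.X).hom ≫ (ρ_ M.X).inv) ≫ M.X ◁ 𝟙 (𝟙_ V)
        simp) }
  inv :=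
    { f := 𝟙 (triv H (𝟙_ V))
      comm := fun M => Mod.hom_ext _ _ (by
        change 𝟙 (𝟙_ V) ▷ M.X ≫ (λ_ M.X).hom ≫ (ρ_ M.X).inv =
          (β_ M.X (𝟙_ V)).inv ≫ M.X ◁ 𝟙 (𝟙_ V)
        simp) }
  hom_inv_id := Center.ext _ _ (Category.comp_id (𝟙 (triv H (𝟙_ V))))
  inv_hom_id := Center.ext _ _ (Category.comp_id (𝟙 (triv H (𝟙_ V))))

lemma act_triv_triv (X Y : V) : act (triv H X ⊗ triv H Y) = act (triv H (X ⊗ Y)) := by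
  rw [act_tensor_triv]
  change (α_ H X Y).inv ≫ (ε[H] ▷ X ≫ (λ_ X).hom) ▷ Y = ε[H] ▷ (X ⊗ Y) ≫ (λ_ (X ⊗ Y)).hom
  monoidal

/-- The tensor constraint, whose underlying morphism is an identity. -/
def centralTensorIso (X Y : V) :
    (centralFunctor H).obj X ⊗ (centralFunctor H).obj Y ≅ (centralFunctor H).obj (X ⊗ Y) where
  hom :=
    { f := mkHom (M := triv H X ⊗ triv H Y) (N := triv H (X ⊗ Y)) (𝟙 (X ⊗ Y)) (comp_id_eq (Z := X ⊗ Y) (act_triv_triv H X Y))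
      comm := fun M => Mod.hom_ext _ _ (by
        change 𝟙 (X ⊗ Y) ▷ M.X ≫ (β_ M.X (X ⊗ Y)).inv =
          ((α_ X Y M.X).hom ≫ X ◁ (β_ M.X Y).inv ≫ (α_ X M.X Y).inv ≫ (β_ M.X X).inv ▷ Y ≫
            (α_ M.X X Y).hom) ≫ M.X ◁ 𝟙 (X ⊗ Y)
        rw [BraidedCategory.braiding_tensor_right_inv]
        simp) }
  inv :=
    { f := mkHom (M := triv H (X ⊗ Y)) (N := triv H X ⊗ triv H Y) (𝟙 (X ⊗ Y)) (comp_id_eq (Z := X ⊗ Y) (act_triv_triv H X Y).symm)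
      comm := fun M => Mod.hom_ext _ _ (by
        change 𝟙 (X ⊗ Y) ▷ M.X ≫ (α_ X Y M.X).hom ≫ X ◁ (β_ M.X Y).inv ≫ (α_ X M.X Y).inv ≫
            (β_ M.X X).inv ▷ Y ≫ (α_ M.X X Y).hom =
          (β_ M.X (X ⊗ Y)).inv ≫ M.X ◁ 𝟙 (X ⊗ Y)
        rw [BraidedCategory.braiding_tensor_right_inv]
        simp) }
  hom_inv_id := Center.ext _ _ (Mod.hom_ext _ _ (Category.comp_id (𝟙 (X ⊗ Y))))
  inv_hom_id := Center.ext _ _ (Mod.hom_ext _ _ (Category.comp_id (𝟙 (X ⊗ Y))))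

noncomputable instance : (centralFunctor (V := V) H).Monoidal :=
  Functor.CoreMonoidal.toMonoidal
    { εIso := centralUnitIso H
      μIso := centralTensorIso H
      μIso_hom_natural_left := fun {X Y} f Z => Center.ext _ _ (Mod.hom_ext _ _ (by
        change f ▷ Z ≫ 𝟙 (Y ⊗ Z) = 𝟙 (X ⊗ Z) ≫ f ▷ Z
        simp))
      μIso_hom_natural_right := fun {X Y} Z f => Center.ext _ _ (Mod.hom_ext _ _ (by
        change Z ◁ f ≫ 𝟙 (Z ⊗ Y) = 𝟙 (Z ⊗ X) ≫ Z ◁ f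
        simp))
      associativity := fun X Y Z => Center.ext _ _ (Mod.hom_ext _ _ (by
        change 𝟙 (X ⊗ Y) ▷ Z ≫ 𝟙 ((X ⊗ Y) ⊗ Z) ≫ (α_ X Y Z).hom =
          (α_ X Y Z).hom ≫ X ◁ 𝟙 (Y ⊗ Z) ≫ 𝟙 (X ⊗ (Y ⊗ Z))
        simp))
      left_unitality := fun X => Center.ext _ _ (Mod.hom_ext _ _ (by
        change (λ_ X).hom = 𝟙 (𝟙_ V) ▷ X ≫ 𝟙 (𝟙_ V ⊗ X) ≫ (λ_ X).hom
        simp))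
      right_unitality := fun X => Center.ext _ _ (Mod.hom_ext _ _ (by
        change (ρ_ X).hom = X ◁ 𝟙 (𝟙_ V) ≫ 𝟙 (X ⊗ 𝟙_ V) ≫ (ρ_ X).hom
        simp)) }
end Triv

section Adjoint
variable {V : Type u} [Category.{v} V] [MonoidalCategory V] [BraidedCategory V]

/-- The braided adjoint action
`m (m ⊗ id) (id ⊗ id ⊗ S) (id ⊗ σ_{H,H}) (Δ ⊗ id)` of a Hopf monoid on itself. -/
def adAct (H : V) [HopfObj H] : H ⊗ H ⟶ H :=
  Δ[H] ▷ H ≫ (α_ H H H).hom ≫ H ◁ (β_ H H).hom ≫ H ◁ H ◁ HopfObj.antipode ≫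
    (α_ H H H).inv ≫ μ[H] ▷ H ≫ μ[H]

/-- The left action of `H` on itself by right multiplication with antipodes. -/
def rAct (H : V) [HopfObj H] : H ⊗ H ⟶ H :=
  (β_ H H).hom ≫ H ◁ HopfObj.antipode ≫ μ[H]

variable (H : V) [HopfObj H]

lemma adAct_eq : adAct H = Δ[H] ▷ H ≫ (α_ H H H).hom ≫ H ◁ rAct H ≫ μ[H] := by
  simp only [adAct, rAct, MonObj.mul_assoc, MonoidalCategory.whiskerLeft_comp, Category.assoc,
    Iso.inv_hom_id_assoc]

lemma one_rAct : η[H] ▷ H ≫ rAct H = (λ_ H).hom := by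
  rw [rAct, BraidedCategory.braiding_naturality_left_assoc,
    ← MonoidalCategory.whiskerLeft_comp_assoc, HopfObj.one_antipode, MonObj.mul_one,
    braiding_rightUnitor]

lemma mul_rAct : μ[H] ▷ H ≫ rAct H = (α_ H H H).hom ≫ H ◁ rAct H ≫ rAct H := by
  have e : (β_ (H ⊗ H) H).hom ≫ H ◁ (β_ H H).hom =
      (α_ H H H).hom ≫ H ◁ (β_ H H).hom ≫ (β_ H (H ⊗ H)).hom ≫ (α_ H H H).hom := by
    rw [BraidedCategory.braiding_tensor_left_hom, BraidedCategory.braiding_tensor_right_hom]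
    simp
  simp only [rAct, MonoidalCategory.whiskerLeft_comp, Category.assoc,
    BraidedCategory.braiding_naturality_left_assoc, BraidedCategory.braiding_naturality_right_assoc]
  rw [← MonoidalCategory.whiskerLeft_comp_assoc, HopfObj.mul_antipode,
    BraidedCategory.braiding_naturality_assoc, MonoidalCategory.whiskerLeft_comp, Category.assoc,
    reassoc_of% e, MonoidalCategory.tensorHom_def]
  simp only [MonoidalCategory.whiskerLeft_comp, Category.assoc]
  rw [← whisker_exchange_assoc, MonObj.mul_assoc, ← BraidedCategory.braiding_naturality_right_assoc]
  monoidal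

lemma rAct_mul : H ◁ μ[H] ≫ rAct H =
    (α_ H H H).inv ≫ (β_ H H).hom ▷ H ≫ (α_ H H H).hom ≫ H ◁ rAct H ≫ μ[H] := by
  rw [rAct, BraidedCategory.braiding_naturality_right_assoc, ← whisker_exchange_assoc,
    MonObj.mul_assoc, BraidedCategory.braiding_tensor_right_hom]
  monoidal

/-- The braided adjoint module: the object `H` with the action `adAct H`. -/
def Had : Mod V H :=
  mkMod H (adAct H)
    (by
      rw [adAct_eq, ← comp_whiskerRight_assoc, Bimon.one_comul]
      calc _ = 𝟙 _ ⊗≫ 𝟙_ V ◁ η[H] ▷ H ⊗≫ (η[H] ▷ (H ⊗ H) ≫ H ◁ rAct H) ≫ μ[H] := by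
            rw [MonoidalCategory.tensorHom_def']; monoidal
        _ = 𝟙 _ ⊗≫ 𝟙_ V ◁ (η[H] ▷ H ≫ rAct H) ⊗≫ (η[H] ▷ H ≫ μ[H]) := by
            rw [← whisker_exchange]; monoidal
        _ = _ := by
            rw [one_rAct, MonObj.one_mul]; monoidal)
    (by
      have e := MonObj.mul_assoc_flip H
      rw [adAct_eq]
      calc _ = (Δ[H] ⊗ₘ Δ[H]) ▷ H ≫ tensorμ H H H H ▷ H ≫ (μ[H] ⊗ₘ μ[H]) ▷ H ≫ (α_ H H H).hom ≫
            H ◁ rAct H ≫ μ[H] := by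
            simp only [← comp_whiskerRight_assoc, BimonObj.mul_comul]
        _ = (Δ[H] ⊗ₘ Δ[H]) ▷ H ≫ tensorμ H H H H ▷ H ⊗≫
            (μ[H] ▷ ((H ⊗ H) ⊗ H) ≫ H ◁ (μ[H] ▷ H ≫ rAct H)) ≫ μ[H] := by
            rw [MonoidalCategory.tensorHom_def μ[H] μ[H]]; monoidal
        _ = (Δ[H] ⊗ₘ Δ[H]) ▷ H ⊗≫ H ◁ (β_ H H).hom ▷ H ▷ H ⊗≫
            (H ⊗ H) ◁ (H ◁ rAct H ≫ rAct H) ≫ μ[H] ▷ H ≫ μ[H] := by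
            rw [← whisker_exchange, mul_rAct]
            simp only [tensorμ]
            monoidal
        _ = 𝟙 _ ⊗≫ (Δ[H] ▷ H ≫ (H ⊗ H) ◁ Δ[H]) ▷ H ⊗≫
            H ◁ ((β_ H H).hom ▷ (H ⊗ H) ≫ (H ⊗ H) ◁ rAct H) ⊗≫ H ◁ (H ◁ rAct H ≫ μ[H]) ≫ μ[H] := by
            rw [MonObj.mul_assoc, MonoidalCategory.tensorHom_def Δ[H] Δ[H]]; monoidal
        _ = 𝟙 _ ⊗≫ (Δ[H] ▷ H ≫ (H ⊗ H) ◁ Δ[H]) ▷ H ⊗≫ (H ⊗ H) ◁ H ◁ rAct H ⊗≫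
            H ◁ (H ◁ μ[H] ≫ rAct H) ≫ μ[H] := by
            rw [← whisker_exchange (β_ H H).hom (rAct H), rAct_mul]; monoidal
        _ = 𝟙 _ ⊗≫ (Δ[H] ▷ (H ⊗ H) ≫ (H ⊗ H) ◁ (Δ[H] ▷ H ≫ (α_ H H H).hom ≫ H ◁ rAct H ≫ μ[H])) ⊗≫
            H ◁ rAct H ≫ μ[H] := by monoidal
        _ = _ := by
            rw [← whisker_exchange]; monoidal)
end Adjoint

section InternalHom

universe v₁ u₁
variable {C : Type u₁} [Category.{v₁} C] [MonoidalCategory C] [RightRigidCategory C]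

/-- The internal Hom of `C`, as a module category over itself: `uHom M N = N ⊗ M^*`. -/
abbrev uHom (M N : C) : C := N ⊗ Mᘁ

variable (C) in
/-- The internal Hom as a functor in both variables. -/
def uHomFunctor : Cᵒᵖ ⥤ C ⥤ C where
  obj M :=
    { obj := fun N => uHom M.unop N
      map := fun g => g ▷ (M.unop)ᘁ
      map_id := fun N => id_whiskerRight N _
      map_comp := fun f g => comp_whiskerRight f g _ }
  map {M M'} f :=
    { app := fun N => N ◁ rightAdjointMate f.unop
      naturality := fun {_ _} g => (whisker_exchange g (rightAdjointMate f.unop)).symm }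
  map_id M := by
    ext N
    change N ◁ rightAdjointMate (𝟙 M.unop) = 𝟙 (N ⊗ (M.unop)ᘁ)
    rw [rightAdjointMate_id, MonoidalCategory.whiskerLeft_id]
  map_comp {M M' M''} f g := by
    ext N
    change N ◁ rightAdjointMate (g.unop ≫ f.unop) = N ◁ rightAdjointMate f.unop ≫ N ◁ rightAdjointMate g.unop
    rw [comp_rightAdjointMate, MonoidalCategory.whiskerLeft_comp]

/-- The natural bijection `Hom(X ⊗ M, N) ≃ Hom(X, uHom M N)`. -/
def homEquiv (X M N : C) : (X ⊗ M ⟶ N) ≃ (X ⟶ uHom M N) := tensorRightHomEquiv X M Mᘁ N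

/-- The internal coevaluation `X ⟶ uHom M (X ⊗ M)`. -/
def uCoev (X M : C) : X ⟶ uHom M (X ⊗ M) := homEquiv X M (X ⊗ M) (𝟙 (X ⊗ M))

/-- The internal evaluation `uHom M N ⊗ M ⟶ N`. -/
def uEv (M N : C) : uHom M N ⊗ M ⟶ N := (homEquiv (uHom M N) M N).symm (𝟙 (uHom M N))

/-- The internal composition. -/
def uComp (M₁ M₂ M₃ : C) : uHom M₂ M₃ ⊗ uHom M₁ M₂ ⟶ uHom M₁ M₃ :=
  homEquiv (uHom M₂ M₃ ⊗ uHom M₁ M₂) M₁ M₃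
    ((α_ (uHom M₂ M₃) (uHom M₁ M₂) M₁).hom ≫ uHom M₂ M₃ ◁ uEv M₁ M₂ ≫ uEv M₂ M₃)

/-- The canonical morphism `X ⊗ uHom M N ⟶ uHom M (X ⊗ N)`. -/
def uA (X M N : C) : X ⊗ uHom M N ⟶ uHom M (X ⊗ N) :=
  uCoev (X ⊗ uHom M N) M ≫
    ((uHomFunctor C).obj (.op M)).map ((α_ X (uHom M N) M).hom ≫ X ◁ uEv M N)

/-- The canonical morphism `uHom (X ⊗ M) N ⊗ X ⟶ uHom M N`. -/
def uB (X M N : C) : uHom (X ⊗ M) N ⊗ X ⟶ uHom M N :=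
  uCoev (uHom (X ⊗ M) N ⊗ X) M ≫
    ((uHomFunctor C).obj (.op M)).map ((α_ (uHom (X ⊗ M) N) X M).hom ≫ uEv (X ⊗ M) N)

end InternalHom

section Relative

universe v₁ u₁ v₂ u₂
variable {V : Type u} [Category.{v} V] [MonoidalCategory V] [RightRigidCategory V]
variable {C : Type u₁} [Category.{v₁} C] [MonoidalCategory C]
variable (G : V ⥤ Center C) [G.Monoidal]

noncomputable section

/-- The action of `V` on `C` through `G`. -/
abbrev vAct (W : V) (M : C) : C := (G.obj W).1 ⊗ M

/-- The associativity constraint `(W ⊗ W') ▷ M ⟶ W ▷ (W' ▷ M)` of the action of `V` on `C`. -/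
def vAssoc (W W' : V) (M : C) : vAct G (W ⊗ W') M ⟶ vAct G W (vAct G W' M) :=
  (Functor.OplaxMonoidal.δ G W W').f ▷ M ≫ (α_ (G.obj W).1 (G.obj W').1 M).hom

/-- The morphism `ev_W ▷ id_M : (W^* ⊗ W) ▷ M ⟶ M`. -/
def vEv (W : V) (M : C) : vAct G (Wᘁ ⊗ W) M ⟶ M :=
  (G.map (ε_ W Wᘁ) ≫ Functor.OplaxMonoidal.η G).f ▷ M ≫ (λ_ M).hom

/-- The evaluation `G(W^*) ⊗ G(W) ⟶ 1` induced by that of `W`. -/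
def gEv (W : V) : (G.obj Wᘁ).1 ⊗ (G.obj W).1 ⟶ 𝟙_ C :=
  (Functor.LaxMonoidal.μ G Wᘁ W ≫ G.map (ε_ W Wᘁ) ≫ Functor.OplaxMonoidal.η G).f

variable {A : Type u₂} [Category.{v₂} A]

/-- The families `π_M : E ⟶ S(M, M)` that are dinatural and compatible with the prebalancing
`β` of the functor `S`. -/
structure IsRelativeCone (S : Cᵒᵖ ⥤ C ⥤ A)
    (β : ∀ (W : V) (M N : C),
      (S.obj (.op M)).obj (vAct G W N) ⟶ (S.obj (.op (vAct G Wᘁ M))).obj N)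
    (E : A) (π : ∀ M : C, E ⟶ (S.obj (.op M)).obj M) : Prop where
  dinatural {M N : C} (f : M ⟶ N) :
    π M ≫ (S.obj (.op M)).map f = π N ≫ (S.map f.op).app N
  relative (W : V) (M : C) :
    π M ≫ (S.map (vEv G W M).op).app M =
      π (vAct G W M) ≫ β W (vAct G W M) M ≫ (S.map (vAssoc G Wᘁ W M).op).app M

/-- The relative end of `(S, β)`: the universal family as in `IsRelativeCone`. -/
structure IsRelativeEnd (S : Cᵒᵖ ⥤ C ⥤ A)
    (β : ∀ (W : V) (M N : C),
      (S.obj (.op M)).obj (vAct G W N) ⟶ (S.obj (.op (vAct G Wᘁ M))).obj N)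
    (E : A) (π : ∀ M : C, E ⟶ (S.obj (.op M)).obj M) : Prop
    extends IsRelativeCone G S β E π where
  universal (E' : A) (ξ : ∀ M : C, E' ⟶ (S.obj (.op M)).obj M) (hξ : IsRelativeCone G S β E' ξ) :
    ∃! h : E' ⟶ E, ∀ M : C, h ≫ π M = ξ M

variable [RightRigidCategory C]

/-- For `f : X ⊗ M ⟶ W ▷ N`, the morphism `X ⊗ (W^* ▷ M) ⟶ N` obtained by moving `X` past `W^*`
with the inverse of the half-braiding of `G(W^*)`, and then applying `f` and the evaluation. -/
def gam (X : C) (W : V) (M N : C) (f : X ⊗ M ⟶ vAct G W N) : X ⊗ vAct G Wᘁ M ⟶ N :=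
  (α_ X (G.obj Wᘁ).1 M).inv ≫ ((G.obj Wᘁ).2.β X).inv ▷ M ≫ (α_ (G.obj Wᘁ).1 X M).hom ≫
    (G.obj Wᘁ).1 ◁ f ≫ (α_ (G.obj Wᘁ).1 (G.obj W).1 N).inv ≫ gEv G W ▷ N ≫ (λ_ N).hom

/-- The prebalancing `uHom M (W ▷ N) ⟶ uHom (W^* ▷ M) N` of the internal Hom. -/
def uPrebalancing (W : V) (M N : C) : uHom M (vAct G W N) ⟶ uHom (vAct G Wᘁ M) N :=
  homEquiv (uHom M (vAct G W N)) (vAct G Wᘁ M) N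
    (gam G (uHom M (vAct G W N)) W M N (uEv M (vAct G W N)))

/-- The object `A` of the center, with an algebra structure and a family of
morphisms `π_M : A ⟶ uHom M M` in `C`, is the algebra `A_{V,C}` in the relative center:
as an object of `C` it is the relative end of the internal Hom, and its half-braiding,
multiplication and unit are the ones determined by `π`. -/
structure IsAdjointAlgebra (A : Center C) [MonObj A] (π : ∀ M : C, A.1 ⟶ uHom M M) : Prop where
  isRelativeEnd : IsRelativeEnd G (uHomFunctor C) (uPrebalancing G) A.1 π
  relativeCenter (W : V) :
    (A.2.β (G.obj W).1).hom ≫ ((G.obj W).2.β A.1).hom = 𝟙 (A.1 ⊗ (G.obj W).1)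
  halfBraiding (X M : C) :
    (A.2.β X).hom ≫ X ◁ π M ≫ uA X M M = π (X ⊗ M) ▷ X ≫ uB X M (X ⊗ M)
  mul (M : C) : μ[A].f ≫ π M = (π M ⊗ₘ π M) ≫ uComp M M M
  one (M : C) : η[A].f ≫ π M = homEquiv (𝟙_ C) M M (λ_ M).hom

end

end Relative

section Adjoint
variable {V : Type u} [Category.{v} V] [MonoidalCategory V] [BraidedCategory V]

/-- The morphism `γ_X = (ρ_X ⊗ id) (id ⊗ σ_{H,X}) (Δ ⊗ id) : H ⊗ X ⟶ X ⊗ H`. -/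
def adBraiding {H : V} [HopfObj H] (X : Mod V H) : H ⊗ X.X ⟶ X.X ⊗ H :=
  Δ[H] ▷ X.X ≫ (α_ H H X.X).hom ≫ H ◁ (β_ H X.X).hom ≫ (α_ H X.X H).inv ≫ act X ▷ H

/-- The morphism `(ρ_X ⊗ id) (id ⊗ coev_X) : H ⟶ X ⊗ X^*`. -/
def adPi [RightRigidCategory V] {H : V} [HopfObj H] (X : Mod V H) : H ⟶ X.X ⊗ (X.X)ᘁ :=
  (ρ_ H).inv ≫ H ◁ η_ X.X (X.X)ᘁ ≫ (α_ H X.X (X.X)ᘁ).inv ≫ act X ▷ (X.X)ᘁ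

/-- The braided adjoint module with a half-braiding, as an object of the center. -/
abbrev HadCenter (H : V) [HopfObj H] (b : HalfBraiding (Had H)) : Center (Mod V H) := ⟨Had H, b⟩

end Adjoint

end BraidedAdjoint

open BraidedAdjoint

namespace BraidedAdjoint

/-! ### Calculus of the adjunction between tensoring and the internal Hom -/

section Transpose

universe v₁ u₁
variable {C : Type u₁} [Category.{v₁} C] [MonoidalCategory C] [RightRigidCategory C]

/-! A morphism `E ⟶ M ⊗ M^*` is the same as an "action" `E ⊗ M ⟶ M`, and every condition of the
theorem becomes transparent in this form. Dinaturality says that module morphisms commute with the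
actions. The relative end condition says that `E` acts on `W ▷ M` by braiding past `W` and then
acting on `M` (`isRelativeCone_centralFunctor_iff`; the converse direction is a zigzag argument).
The equations for multiplication, unit and half-braiding say that the actions are associative,
unital and compatible with tensor products. The family `π` corresponds to the module structures
themselves.

Universality: each module `M` is the image of the action map from `M ⊗ H`, trivial module times
regular module. A compatible family is therefore determined by its value on the regular module, in
fact by `φ : E ⟶ H`, the action on the unit of `H` (`actOf_eq_act`). That `φ` is linear for the
adjoint action is the identity `(k₁ · h) k₂ = k h` read backwards (`action_of_gamma`). The same
criterion makes `γ_X`, `m` and `u` linear, since after multiplication by `H` on the right they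
become module actions.

The delicate point is invertibility of `γ`, proved without an inverse of the antipode. Naturality
and the hexagon make `γ` invertible on every dual module (`isIso_of_exactPairing`), and on trivial
modules it is the braiding. The regular module is a coalgebra in the category of modules, so its
dual is a Hopf module. The Larson–Sweedler argument then exhibits the regular module as a retract of
`triv H H ⊗ (regMod H)ᘁ` (`exists_retract_dual`). Hence `γ` is invertible on the regular module, on
free modules, and by presentations on all modules.

Below, `h₁ ⊗ h₂` and `n₋₁ ⊗ n₀` are Sweedler notation with the braidings left implicit. -/

lemma homEquiv_symm_apply {X M N : C} (f : X ⟶ uHom M N) :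
    (homEquiv X M N).symm f = f ▷ M ≫ (α_ N Mᘁ M).hom ≫ N ◁ ε_ M Mᘁ ≫ (ρ_ N).hom := rfl

lemma homEquiv_symm_precomp {X X' M N : C} (h : X' ⟶ X) (f : X ⟶ uHom M N) :
    (homEquiv X' M N).symm (h ≫ f) = h ▷ M ≫ (homEquiv X M N).symm f := by
  simp [homEquiv_symm_apply]

lemma homEquiv_symm_postcomp {X M N N' : C} (f : X ⟶ uHom M N) (g : N ⟶ N') :
    (homEquiv X M N').symm (f ≫ g ▷ Mᘁ) = (homEquiv X M N).symm f ≫ g := by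
  simp only [homEquiv_symm_apply, comp_whiskerRight, Category.assoc,
    associator_naturality_left_assoc, ← whisker_exchange_assoc, rightUnitor_naturality]

lemma rightAdjointMate_ev {M N : C} (f : M ⟶ N) :
    rightAdjointMate f ▷ M ≫ ε_ M Mᘁ = Nᘁ ◁ f ≫ ε_ N Nᘁ := by
  exact rightAdjointMate_comp_evaluation f

lemma homEquiv_symm_mate {X M M' N : C} (f : M ⟶ M') (p : X ⟶ uHom M' N) :
    (homEquiv X M N).symm (p ≫ N ◁ rightAdjointMate f) =
      X ◁ f ≫ (homEquiv X M' N).symm p := by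
  have e := rightAdjointMate_ev f
  rw [homEquiv_symm_precomp, homEquiv_symm_apply, homEquiv_symm_apply,
    associator_naturality_middle_assoc, ← MonoidalCategory.whiskerLeft_comp_assoc, e,
    whisker_exchange_assoc]
  simp

lemma whiskerRight_uEv {X M N : C} (f : X ⟶ uHom M N) :
    f ▷ M ≫ uEv M N = (homEquiv X M N).symm f := by
  rw [uEv, ← homEquiv_symm_precomp, Category.comp_id]

/-- Turns `uA` and `uB`, defined through the internal coevaluation, into images under the
adjunction. -/
lemma uCoev_postcomp {X M N : C} (f : X ⊗ M ⟶ N) :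
    uCoev X M ≫ ((uHomFunctor C).obj (.op M)).map f = homEquiv X M N f := by
  apply (homEquiv X M N).symm.injective
  change (homEquiv X M N).symm (uCoev X M ≫ f ▷ Mᘁ) = _
  rw [homEquiv_symm_postcomp, uCoev, Equiv.symm_apply_apply, Equiv.symm_apply_apply,
    Category.id_comp]

lemma uA_eq (X M N : C) :
    uA X M N = homEquiv _ _ _ ((α_ X (uHom M N) M).hom ≫ X ◁ uEv M N) :=
  uCoev_postcomp _

lemma uB_eq (X M N : C) :
    uB X M N = homEquiv _ _ _ ((α_ (uHom (X ⊗ M) N) X M).hom ≫ uEv (X ⊗ M) N) :=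
  uCoev_postcomp _

lemma homEquiv_symm_uA {E X M N : C} (f : E ⟶ X ⊗ uHom M N) :
    (homEquiv E M (X ⊗ N)).symm (f ≫ uA X M N) =
      f ▷ M ≫ (α_ X (uHom M N) M).hom ≫ X ◁ uEv M N := by
  rw [uA_eq, homEquiv_symm_precomp, Equiv.symm_apply_apply]

lemma homEquiv_symm_uB {E X M N : C} (f : E ⟶ uHom (X ⊗ M) N) :
    (homEquiv (E ⊗ X) M N).symm (f ▷ X ≫ uB X M N) =
      (α_ E X M).hom ≫ (homEquiv E (X ⊗ M) N).symm f := by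
  rw [uB_eq, homEquiv_symm_precomp, Equiv.symm_apply_apply,
    associator_naturality_left_assoc, whiskerRight_uEv]

lemma homEquiv_symm_uComp {E F M₁ M₂ M₃ : C} (f : E ⟶ uHom M₂ M₃) (g : F ⟶ uHom M₁ M₂) :
    (homEquiv (E ⊗ F) M₁ M₃).symm ((f ⊗ₘ g) ≫ uComp M₁ M₂ M₃) =
      (α_ E F M₁).hom ≫ E ◁ (homEquiv F M₁ M₂).symm g ≫ (homEquiv E M₂ M₃).symm f := by
  rw [uComp, homEquiv_symm_precomp, Equiv.symm_apply_apply, ← whiskerRight_uEv, ← whiskerRight_uEv,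
    MonoidalCategory.tensorHom_def']
  simp only [comp_whiskerRight, Category.assoc, associator_naturality_left_assoc,
    associator_naturality_middle_assoc, MonoidalCategory.whiskerLeft_comp, whisker_exchange_assoc]

end Transpose

/-! ### The defining conditions of the relative end and its algebra structure, transposed -/

section Cone

universe v₁ u₁
variable {V : Type u} [Category.{v} V] [MonoidalCategory V] [RightRigidCategory V]
variable {C : Type u₁} [Category.{v₁} C] [MonoidalCategory C]
variable (G : V ⥤ Center C) [G.Monoidal]

/-- Naturality of the half-braiding of `G(W^*)` in the object that moves past it. -/
lemma gam_precomp {X X' : C} (h : X' ⟶ X) (W : V) (M N : C) (f : X ⊗ M ⟶ vAct G W N) :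
    h ▷ vAct G Wᘁ M ≫ gam G X W M N f = gam G X' W M N (h ▷ M ≫ f) := by
  have e : h ▷ (G.obj Wᘁ).1 ≫ ((G.obj Wᘁ).2.β X).inv =
      ((G.obj Wᘁ).2.β X').inv ≫ (G.obj Wᘁ).1 ◁ h := by
    rw [Iso.comp_inv_eq, Category.assoc, Iso.eq_inv_comp, HalfBraiding.naturality]
  simp only [gam, associator_inv_naturality_left_assoc, ← comp_whiskerRight_assoc, e]
  simp only [comp_whiskerRight, Category.assoc, associator_naturality_middle_assoc,
    MonoidalCategory.whiskerLeft_comp]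

variable [RightRigidCategory C]

lemma homEquiv_symm_uPrebalancing {E : C} (W : V) (M N : C) (f : E ⟶ uHom M (vAct G W N)) :
    (homEquiv E (vAct G Wᘁ M) N).symm (f ≫ uPrebalancing G W M N) =
      gam G E W M N ((homEquiv E M (vAct G W N)).symm f) := by
  rw [uPrebalancing, homEquiv_symm_precomp, Equiv.symm_apply_apply, gam_precomp, whiskerRight_uEv]

/-- The adjunction turns functoriality of the internal Hom in its second variable into
postcomposition, and in its first into precomposition; being injective, it loses nothing. -/
lemma isRelativeCone_iff (E : C) (π : ∀ M : C, E ⟶ uHom M M) :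
    IsRelativeCone G (uHomFunctor C) (uPrebalancing G) E π ↔
      (∀ {M N : C} (f : M ⟶ N), (homEquiv E M M).symm (π M) ≫ f =
        E ◁ f ≫ (homEquiv E N N).symm (π N)) ∧
      ∀ (W : V) (M : C), E ◁ vEv G W M ≫ (homEquiv E M M).symm (π M) =
        E ◁ vAssoc G Wᘁ W M ≫ gam G E W (vAct G W M) M
          ((homEquiv E (vAct G W M) (vAct G W M)).symm (π (vAct G W M))) := by
  have h1 {M N : C} (f : M ⟶ N) :
      (π M ≫ ((uHomFunctor C).obj (.op M)).map f = π N ≫ ((uHomFunctor C).map f.op).app N) ↔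
      (homEquiv E M M).symm (π M) ≫ f = E ◁ f ≫ (homEquiv E N N).symm (π N) := by
    rw [← homEquiv_symm_postcomp, ← homEquiv_symm_mate]
    exact (homEquiv E M N).symm.injective.eq_iff.symm
  have h2 (W : V) (M : C) : (π M ≫ ((uHomFunctor C).map (vEv G W M).op).app M =
      π (vAct G W M) ≫ uPrebalancing G W (vAct G W M) M ≫
        ((uHomFunctor C).map (vAssoc G Wᘁ W M).op).app M) ↔
      E ◁ vEv G W M ≫ (homEquiv E M M).symm (π M) =
        E ◁ vAssoc G Wᘁ W M ≫ gam G E W (vAct G W M) M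
          ((homEquiv E (vAct G W M) (vAct G W M)).symm (π (vAct G W M))) := by
    rw [← homEquiv_symm_uPrebalancing, ← homEquiv_symm_mate, ← homEquiv_symm_mate, Category.assoc]
    exact (homEquiv E (vAct G (Wᘁ ⊗ W) M) M).symm.injective.eq_iff.symm
  exact ⟨fun h => ⟨fun f => (h1 f).1 (h.dinatural f), fun W M => (h2 W M).1 (h.relative W M)⟩,
    fun h => ⟨fun f => (h1 f).2 (h.1 f), fun W M => (h2 W M).2 (h.2 W M)⟩⟩

lemma halfBraiding_iff {A : C} {X M : C} (b : A ⊗ X ⟶ X ⊗ A) (p : A ⟶ uHom M M)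
    (q : A ⟶ uHom (X ⊗ M) (X ⊗ M)) :
    b ≫ X ◁ p ≫ uA X M M = q ▷ X ≫ uB X M (X ⊗ M) ↔
      b ▷ M ≫ (α_ X A M).hom ≫ X ◁ (homEquiv A M M).symm p =
        (α_ A X M).hom ≫ (homEquiv A (X ⊗ M) (X ⊗ M)).symm q := by
  rw [← (homEquiv (A ⊗ X) M (X ⊗ M)).symm.injective.eq_iff, homEquiv_symm_uB, ← Category.assoc b,
    homEquiv_symm_uA, ← whiskerRight_uEv p]
  simp only [comp_whiskerRight, Category.assoc, associator_naturality_middle_assoc,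
    MonoidalCategory.whiskerLeft_comp]

lemma mul_iff {A M : C} (m : A ⊗ A ⟶ A) (p : A ⟶ uHom M M) :
    m ≫ p = (p ⊗ₘ p) ≫ uComp M M M ↔
      m ▷ M ≫ (homEquiv A M M).symm p =
        (α_ A A M).hom ≫ A ◁ (homEquiv A M M).symm p ≫ (homEquiv A M M).symm p := by
  rw [← (homEquiv (A ⊗ A) M M).symm.injective.eq_iff, homEquiv_symm_uComp, homEquiv_symm_precomp]

lemma one_iff {A M : C} (e : 𝟙_ C ⟶ A) (p : A ⟶ uHom M M) :
    e ≫ p = homEquiv (𝟙_ C) M M (λ_ M).hom ↔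
      e ▷ M ≫ (homEquiv A M M).symm p = (λ_ M).hom := by
  rw [← (homEquiv (𝟙_ C) M M).symm.injective.eq_iff, Equiv.symm_apply_apply, homEquiv_symm_precomp]

end Cone

/-! ### The morphisms `γ` and the adjoint action -/

section Coaction

variable {V : Type u} [Category.{v} V] [MonoidalCategory V] [BraidedCategory V]
variable {H X Y : V}

/-- The morphism `(a ⊗ id) (id ⊗ σ_{H,X}) (Δ ⊗ id) : H ⊗ X ⟶ X ⊗ H` associated with
`a : H ⊗ X ⟶ X`. -/
def gamma [ComonObj H] (a : H ⊗ X ⟶ X) : H ⊗ X ⟶ X ⊗ H :=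
  Δ[H] ▷ X ≫ (α_ H H X).hom ≫ H ◁ (β_ H X).hom ≫ (α_ H X H).inv ≫ a ▷ H

/-- The tensor product of two morphisms `H ⊗ X ⟶ X` and `H ⊗ Y ⟶ Y`. -/
def tAct [ComonObj H] (a : H ⊗ X ⟶ X) (b : H ⊗ Y ⟶ Y) : H ⊗ (X ⊗ Y) ⟶ X ⊗ Y :=
  Δ[H] ▷ (X ⊗ Y) ≫ tensorμ H H X Y ≫ (a ⊗ₘ b)

section Comon
variable [ComonObj H]

/-- `gamma a` is the first half of the diagonal action: `h₁` has acted on `X` and `h₂` has arrived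
next to `Y`. Most later computations use the tensor action in this form. -/
lemma tAct_eq (a : H ⊗ X ⟶ X) (b : H ⊗ Y ⟶ Y) :
    tAct a b = (α_ H X Y).inv ≫ gamma a ▷ Y ≫ (α_ X H Y).hom ≫ X ◁ b := by
  rw [tAct, MonoidalCategory.tensorHom_def]
  simp only [tensorμ, gamma]
  monoidal

lemma gamma_counit (a : H ⊗ X ⟶ X) : gamma a ≫ X ◁ ε[H] = a ≫ (ρ_ X).inv := by
  calc _ = Δ[H] ▷ X ⊗≫ H ◁ ((β_ H X).hom ≫ X ◁ ε[H]) ⊗≫ a ⊗≫ 𝟙 _ := by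
        rw [gamma]
        simp only [Category.assoc]
        rw [← whisker_exchange]
        monoidal
    _ = (Δ[H] ≫ H ◁ ε[H]) ▷ X ⊗≫ a ⊗≫ 𝟙 _ := by
        rw [← BraidedCategory.braiding_naturality_left, braiding_tensorUnit_left]; monoidal
    _ = _ := by
        rw [ComonObj.comul_counit]; monoidal

/-- Coassociativity: both sides are `h ⊗ x ↦ h₁ x ⊗ h₂ ⊗ h₃`. -/
lemma gamma_comul (a : H ⊗ X ⟶ X) : gamma a ≫ X ◁ Δ[H] =
    Δ[H] ▷ X ≫ (α_ H H X).hom ≫ H ◁ (β_ H X).hom ≫ (α_ H X H).inv ≫ gamma a ▷ H ≫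
      (α_ X H H).hom := by
  calc _ = Δ[H] ▷ X ⊗≫ H ◁ ((β_ H X).hom ≫ X ◁ Δ[H]) ⊗≫ a ▷ (H ⊗ H) := by
        rw [gamma]
        simp only [Category.assoc]
        rw [← whisker_exchange]
        monoidal
    _ = (Δ[H] ≫ H ◁ Δ[H]) ▷ X ⊗≫ H ◁ (β_ (H ⊗ H) X).hom ⊗≫ a ▷ (H ⊗ H) := by
        rw [← BraidedCategory.braiding_naturality_left]; monoidal
    _ = (Δ[H] ≫ Δ[H] ▷ H ≫ (α_ H H H).hom) ▷ X ⊗≫ H ◁ (β_ (H ⊗ H) X).hom ⊗≫ a ▷ (H ⊗ H) := by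
        rw [ComonObj.comul_assoc]
    _ = Δ[H] ▷ X ⊗≫ (Δ[H] ▷ (H ⊗ X) ≫ (H ⊗ H) ◁ (β_ H X).hom) ⊗≫ H ◁ (β_ H X).hom ▷ H ⊗≫
          a ▷ (H ⊗ H) := by
        rw [BraidedCategory.braiding_tensor_left_hom]; monoidal
    _ = _ := by
        rw [← whisker_exchange, gamma]; monoidal

/-- The hexagon for `γ`; it is coassociativity in the form of `gamma_comul`. -/
lemma gamma_tAct (a : H ⊗ X ⟶ X) (b : H ⊗ Y ⟶ Y) : gamma (tAct a b) =
    (α_ H X Y).inv ≫ gamma a ▷ Y ≫ (α_ X H Y).hom ≫ X ◁ gamma b ≫ (α_ X Y H).inv := by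
  symm
  calc _ = 𝟙 _ ⊗≫ (gamma a ≫ X ◁ Δ[H]) ▷ Y ⊗≫ X ◁ H ◁ (β_ H Y).hom ⊗≫ X ◁ b ▷ H ⊗≫ 𝟙 _ := by
        rw [gamma.eq_def b]; monoidal
    _ = 𝟙 _ ⊗≫ Δ[H] ▷ (X ⊗ Y) ⊗≫ H ◁ (β_ H X).hom ▷ Y ⊗≫ (gamma a ▷ (H ⊗ Y) ≫
          (X ⊗ H) ◁ (β_ H Y).hom) ⊗≫ X ◁ b ▷ H ⊗≫ 𝟙 _ := by
        rw [gamma_comul]; monoidal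
    _ = _ := by
        rw [← whisker_exchange, gamma.eq_def (tAct a b), tAct_eq,
          BraidedCategory.braiding_tensor_right_hom]
        monoidal

lemma gamma_naturality {a : H ⊗ X ⟶ X} {b : H ⊗ Y ⟶ Y} (f : X ⟶ Y) (h : a ≫ f = H ◁ f ≫ b) :
    H ◁ f ≫ gamma b = gamma a ≫ f ▷ H := by
  calc _ = (H ◁ f ≫ Δ[H] ▷ Y) ⊗≫ H ◁ (β_ H Y).hom ⊗≫ b ▷ H := by
        rw [gamma]; monoidal
    _ = Δ[H] ▷ X ⊗≫ H ◁ (H ◁ f ≫ (β_ H Y).hom) ⊗≫ b ▷ H := by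
        rw [whisker_exchange]; monoidal
    _ = Δ[H] ▷ X ⊗≫ H ◁ (β_ H X).hom ⊗≫ (H ◁ f ≫ b) ▷ H := by
        rw [BraidedCategory.braiding_naturality_right]; monoidal
    _ = _ := by
        rw [← h, gamma]; monoidal

/-- The counit absorbs the leg that would act. This gives both invertibility of `γ` on trivial
modules and membership in the relative center. -/
lemma gamma_eq_braiding (X : V) : gamma (ε[H] ▷ X ≫ (λ_ X).hom) = (β_ H X).hom := by
  calc _ = Δ[H] ▷ X ⊗≫ (H ◁ (β_ H X).hom ≫ ε[H] ▷ (X ⊗ H)) ⊗≫ 𝟙 _ := by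
        rw [gamma]; monoidal
    _ = (Δ[H] ≫ ε[H] ▷ H) ▷ X ⊗≫ (β_ H X).hom := by
        rw [whisker_exchange]; monoidal
    _ = _ := by
        rw [ComonObj.counit_comul]; monoidal

end Comon

section Hopf
variable [HopfObj H]

lemma whiskerLeft_one_tAct (a : H ⊗ X ⟶ X) :
    H ◁ X ◁ η[H] ≫ tAct a μ[H] = H ◁ (ρ_ X).hom ≫ gamma a := by
  calc _ = 𝟙 _ ⊗≫ ((H ⊗ X) ◁ η[H] ≫ gamma a ▷ H) ⊗≫ X ◁ μ[H] := by
        rw [tAct_eq]; monoidal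
    _ = 𝟙 _ ⊗≫ gamma a ⊗≫ X ◁ (H ◁ η[H] ≫ μ[H]) := by
        rw [whisker_exchange]; monoidal
    _ = _ := by
        rw [MonObj.mul_one]; monoidal

lemma adAct_eq_gamma : adAct H = gamma μ[H] ≫ H ◁ HopfObj.antipode ≫ μ[H] := by
  calc _ = Δ[H] ▷ H ⊗≫ H ◁ (β_ H H).hom ⊗≫ ((H ⊗ H) ◁ HopfObj.antipode ≫ μ[H] ▷ H) ≫ μ[H] := by
        rw [adAct]; monoidal
    _ = _ := by
        rw [whisker_exchange, gamma]; monoidal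

/-- The adjoint action is characterized by `(k₁ · h) k₂ = k h`, and similarly for modules with a
compatible right multiplication by `H`. -/
lemma action_of_gamma {E B : V} (a : H ⊗ E ⟶ E) (b b' : H ⊗ B ⟶ B) (r : B ⊗ H ⟶ B)
    (r_one : B ◁ η[H] ≫ r = (ρ_ B).hom)
    (r_mul : B ◁ μ[H] ≫ r = (α_ B H H).inv ≫ r ▷ H ≫ r)
    (hb : b' = gamma b ≫ B ◁ HopfObj.antipode ≫ r)
    (φ : E ⟶ B) (h : tAct a μ[H] ≫ φ ▷ H ≫ r = H ◁ (φ ▷ H ≫ r) ≫ b) :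
    a ≫ φ = H ◁ φ ≫ b' := by
  have h1 : H ◁ φ ≫ b = gamma a ≫ φ ▷ H ≫ r := by
    -- Putting the unit of `H` into the last factor of `h` leaves `φ(k₁ e) k₂ = k φ(e)`.
    have e := congrArg (fun t => H ◁ (ρ_ E).inv ≫ H ◁ E ◁ η[H] ≫ t) h
    have e1 := whiskerLeft_one_tAct a
    have e2 : E ◁ η[H] ≫ φ ▷ H ≫ r = (ρ_ E).hom ≫ φ := by
      rw [whisker_exchange_assoc, r_one, rightUnitor_naturality]
    rw [reassoc_of% e1, ← MonoidalCategory.whiskerLeft_comp_assoc H (E ◁ η[H]), e2] at e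
    simpa using e.symm
  -- `φ(k e) = φ(k₁ e) k₂ S(k₃) = (k₁ φ(e)) S(k₂)`: a counit is inserted, expanded by the antipode
  -- axiom, and `h1` is applied to the first two legs.
  calc _ = gamma a ≫ E ◁ ε[H] ≫ (ρ_ E).hom ≫ φ := by
        rw [reassoc_of% gamma_counit a]; simp
    _ = gamma a ≫ (φ ▷ H ≫ B ◁ (ε[H] ≫ η[H])) ≫ r := by
        rw [← whisker_exchange, MonoidalCategory.whiskerLeft_comp]
        simp only [Category.assoc]
        rw [whisker_exchange_assoc, r_one, rightUnitor_naturality]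
    _ = (gamma a ≫ E ◁ Δ[H]) ≫ φ ▷ (H ⊗ H) ≫ B ◁ (H ◁ HopfObj.antipode ≫ μ[H]) ≫ r := by
        rw [← HopfObj.antipode_right]
        simp only [MonoidalCategory.whiskerLeft_comp, Category.assoc]
        rw [whisker_exchange_assoc]
    _ = Δ[H] ▷ E ⊗≫ H ◁ (β_ H E).hom ⊗≫ (gamma a ≫ φ ▷ H) ▷ H ⊗≫
          ((B ⊗ H) ◁ HopfObj.antipode ≫ r ▷ H) ≫ r := by
        rw [gamma_comul]
        simp only [MonoidalCategory.whiskerLeft_comp, Category.assoc, r_mul]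
        monoidal
    _ = Δ[H] ▷ E ⊗≫ H ◁ (β_ H E).hom ⊗≫ (gamma a ≫ φ ▷ H ≫ r) ▷ H ⊗≫
          B ◁ HopfObj.antipode ≫ r := by
        rw [whisker_exchange]; monoidal
    _ = Δ[H] ▷ E ⊗≫ H ◁ ((β_ H E).hom ≫ φ ▷ H) ⊗≫ b ▷ H ⊗≫ B ◁ HopfObj.antipode ≫ r := by
        rw [← h1]; monoidal
    _ = (Δ[H] ▷ E ≫ (H ⊗ H) ◁ φ) ⊗≫ H ◁ (β_ H B).hom ⊗≫ b ▷ H ⊗≫ B ◁ HopfObj.antipode ≫ r := by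
        rw [← BraidedCategory.braiding_naturality_right]; monoidal
    _ = _ := by
        rw [← whisker_exchange, hb, gamma]; monoidal

/-- `(k₁ · h) k₂ = k₁ h S(k₂) k₃ = k h`. -/
lemma gamma_adAct_mul : gamma (adAct H) ≫ μ[H] = μ[H] := by
  calc _ = gamma (adAct H) ≫ H ◁ 𝟙 H ≫ μ[H] := by simp
    _ = Δ[H] ▷ H ⊗≫ H ◁ (β_ H H).hom ⊗≫ gamma μ[H] ▷ H ⊗≫
          (H ◁ HopfObj.antipode (X := H) ≫ μ[H]) ▷ H ≫ μ[H] := by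
        rw [gamma.eq_def (adAct H), adAct_eq_gamma]; monoidal
    _ = (Δ[H] ▷ H ≫ (α_ H H H).hom ≫ H ◁ (β_ H H).hom ≫ (α_ H H H).inv ≫ gamma μ[H] ▷ H ≫
        (α_ H H H).hom) ⊗≫ H ◁ HopfObj.antipode (X := H) ▷ H ⊗≫ μ[H] ▷ H ≫ μ[H] := by
        monoidal
    _ = gamma μ[H] ≫ H ◁ (Δ[H] ≫ HopfObj.antipode ▷ H ≫ μ[H]) ≫ μ[H] := by
        rw [← gamma_comul, MonObj.mul_assoc]; monoidal
    _ = (gamma μ[H] ≫ H ◁ ε[H]) ≫ H ◁ η[H] ≫ μ[H] := by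
        rw [HopfObj.antipode_left]; simp
    _ = _ := by
        rw [gamma_counit, MonObj.mul_one]; simp

/-- Shows that `X ⊗ H` with the adjoint action on `H` has the shape required by `action_of_gamma`:
the diagonal action with the regular module, corrected on the right by the antipode. -/
lemma tAct_adAct (a : H ⊗ X ⟶ X) :
    tAct a (adAct H) =
      gamma (tAct a μ[H]) ≫ (X ⊗ H) ◁ HopfObj.antipode ≫ (α_ X H H).hom ≫ X ◁ μ[H] := by
  rw [gamma_tAct, tAct_eq, adAct_eq_gamma]
  monoidal

/-- A module acts on itself by a morphism of modules, if `H` carries the adjoint action. -/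
lemma tAct_adAct_act (a : H ⊗ X ⟶ X) (ha : μ[H] ▷ X ≫ a = (α_ H H X).hom ≫ H ◁ a ≫ a) :
    tAct (adAct H) a ≫ a = H ◁ a ≫ a := by
  rw [tAct_eq]
  simp only [Category.assoc]
  rw [← ha, ← comp_whiskerRight_assoc, gamma_adAct_mul, ha, Iso.inv_hom_id_assoc]

/-- The hypothesis says that `e ⊗ h ↦ φ(e) h` is linear for the regular action, so linearity into
the adjoint module can be tested on the regular module. -/
lemma hom_Had_of {E : V} (a : H ⊗ E ⟶ E) (φ : E ⟶ H)
    (h : tAct a μ[H] ≫ φ ▷ H ≫ μ[H] = H ◁ (φ ▷ H ≫ μ[H]) ≫ μ[H]) :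
    a ≫ φ = H ◁ φ ≫ adAct H :=
  action_of_gamma a μ[H] (adAct H) μ[H] (MonObj.mul_one H) (MonObj.mul_assoc_flip H)
    adAct_eq_gamma φ h

lemma hom_tensor_Had_of {E Q : V} (a : H ⊗ E ⟶ E) (b : H ⊗ Q ⟶ Q) (φ : E ⟶ Q ⊗ H)
    (h : tAct a μ[H] ≫ φ ▷ H ≫ (α_ Q H H).hom ≫ Q ◁ μ[H] =
      H ◁ (φ ▷ H ≫ (α_ Q H H).hom ≫ Q ◁ μ[H]) ≫ tAct b μ[H]) :
    a ≫ φ = H ◁ φ ≫ tAct b (adAct H) :=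
  action_of_gamma a (tAct b μ[H]) _ ((α_ Q H H).hom ≫ Q ◁ μ[H])
    (by
      rw [associator_naturality_right_assoc, ← MonoidalCategory.whiskerLeft_comp, MonObj.mul_one]
      monoidal)
    (by
      rw [associator_naturality_right_assoc, ← MonoidalCategory.whiskerLeft_comp,
        MonObj.mul_assoc_flip]
      monoidal)
    (tAct_adAct b) φ h

lemma ext_mul {E Q : V} {f g : E ⟶ Q ⊗ H}
    (h : f ▷ H ≫ (α_ Q H H).hom ≫ Q ◁ μ[H] = g ▷ H ≫ (α_ Q H H).hom ≫ Q ◁ μ[H]) : f = g := by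
  have key (f : E ⟶ Q ⊗ H) :
      f = (ρ_ E).inv ≫ E ◁ η[H] ≫ f ▷ H ≫ (α_ Q H H).hom ≫ Q ◁ μ[H] := by
    rw [whisker_exchange_assoc, associator_naturality_right_assoc,
      ← MonoidalCategory.whiskerLeft_comp, MonObj.mul_one]
    simp
  rw [key f, key g, h]

end Hopf

end Coaction

/-! ### The relative end condition as compatibility with the braiding -/

section Snake

variable {V : Type u} [Category.{v} V] [MonoidalCategory V] [BraidedCategory V]

/-- Moving `E` past `Y` and then past `W` is moving it past `Y ⊗ W`, and the braiding is natural
along the evaluation. -/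
lemma relative_of_braided {E W Y M : V} [ExactPairing W Y] (a : E ⊗ M ⟶ M)
    (c : E ⊗ (W ⊗ M) ⟶ W ⊗ M)
    (h : c = (α_ E W M).inv ≫ (β_ E W).hom ▷ M ≫ (α_ W E M).hom ≫ W ◁ a) :
    E ◁ (ε_ W Y ▷ M ≫ (λ_ M).hom) ≫ a =
      E ◁ (α_ Y W M).hom ≫ (α_ E Y (W ⊗ M)).inv ≫ (β_ E Y).hom ▷ (W ⊗ M) ≫
        (α_ Y E (W ⊗ M)).hom ≫ Y ◁ c ≫ (α_ Y W M).inv ≫ ε_ W Y ▷ M ≫ (λ_ M).hom := by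
  symm
  calc _ = 𝟙 _ ⊗≫ ((β_ E Y).hom ▷ W ⊗≫ Y ◁ (β_ E W).hom) ▷ M ⊗≫
        ((Y ⊗ W) ◁ a ≫ ε_ W Y ▷ M) ⊗≫ 𝟙 _ := by
        rw [h]; monoidal
    _ = 𝟙 _ ⊗≫ ((β_ E (Y ⊗ W)).hom ≫ ε_ W Y ▷ E) ▷ M ⊗≫ a := by
        rw [whisker_exchange, BraidedCategory.braiding_tensor_right_hom]; monoidal
    _ = _ := by
        rw [← BraidedCategory.braiding_naturality_right, braiding_tensorUnit_right]; monoidal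

/-- A zigzag for `W` is inserted to create an evaluation, the hypothesis is applied under it, and
naturality of the braiding along the coevaluation removes the zigzag. -/
lemma braided_of_relative {E W Y M : V} [ExactPairing W Y] (a : E ⊗ M ⟶ M)
    (c : E ⊗ (W ⊗ M) ⟶ W ⊗ M)
    (h : E ◁ (ε_ W Y ▷ M ≫ (λ_ M).hom) ≫ a =
      E ◁ (α_ Y W M).hom ≫ (α_ E Y (W ⊗ M)).inv ≫ (β_ E Y).hom ▷ (W ⊗ M) ≫
        (α_ Y E (W ⊗ M)).hom ≫ Y ◁ c ≫ (α_ Y W M).inv ≫ ε_ W Y ▷ M ≫ (λ_ M).hom) :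
    c = (α_ E W M).inv ≫ (β_ E W).hom ▷ M ≫ (α_ W E M).hom ≫ W ◁ a := by
  symm
  calc _ = 𝟙 _ ⊗≫ E ◁ (η_ W Y ▷ W ⊗≫ W ◁ ε_ W Y) ▷ M ⊗≫ (β_ E W).hom ▷ M ⊗≫ W ◁ a := by
        rw [ExactPairing.evaluation_coevaluation'']; monoidal
    _ = 𝟙 _ ⊗≫ E ◁ η_ W Y ▷ (W ⊗ M) ⊗≫ ((E ⊗ W) ◁ ε_ W Y ≫ (β_ E W).hom ▷ 𝟙_ V) ▷ M ⊗≫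
          W ◁ a := by
        monoidal
    _ = 𝟙 _ ⊗≫ E ◁ η_ W Y ▷ (W ⊗ M) ⊗≫ (β_ E W).hom ▷ (Y ⊗ W) ▷ M ⊗≫
          W ◁ (E ◁ (ε_ W Y ▷ M ≫ (λ_ M).hom) ≫ a) := by
        rw [whisker_exchange]; monoidal
    _ = 𝟙 _ ⊗≫ (E ◁ η_ W Y ≫ (β_ E (W ⊗ Y)).hom) ▷ (W ⊗ M) ⊗≫ (W ⊗ Y) ◁ c ⊗≫
          W ◁ ε_ W Y ▷ M ⊗≫ 𝟙 _ := by
        rw [h, BraidedCategory.braiding_tensor_right_hom]; monoidal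
    _ = 𝟙 _ ⊗≫ (η_ W Y ▷ (E ⊗ (W ⊗ M)) ≫ (W ⊗ Y) ◁ c) ⊗≫ W ◁ ε_ W Y ▷ M ⊗≫ 𝟙 _ := by
        rw [BraidedCategory.braiding_naturality_right, braiding_tensorUnit_right]; monoidal
    _ = c ⊗≫ (η_ W Y ▷ W ⊗≫ W ◁ ε_ W Y) ▷ M ⊗≫ 𝟙 _ := by
        rw [← whisker_exchange]; monoidal
    _ = _ := by
        rw [ExactPairing.evaluation_coevaluation'']; monoidal

end Snake

/-! ### The adjoint module as the relative end -/

section Regular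

variable {V : Type u} [Category.{v} V] [MonoidalCategory V] [BraidedCategory V]
variable (H : V) [HopfObj H]

/-- The regular module. -/
def regMod : Mod V H := mkMod H μ[H] (MonObj.one_mul H) (MonObj.mul_assoc H)

variable {H}

/-- The morphism from a free module given by a morphism in `V`. -/
def freeHom {X : V} (Q : Mod V H) (f : X ⟶ Q.X) : regMod H ⊗ triv H X ⟶ Q :=
  mkHom (M := regMod H ⊗ triv H X) (H ◁ f ≫ act Q) (by
    rw [act_tensor_triv]
    change ((α_ H H X).inv ≫ μ[H] ▷ X) ≫ H ◁ f ≫ act Q =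
      H ◁ (H ◁ f ≫ act Q) ≫ act Q
    rw [Category.assoc, ← whisker_exchange_assoc, mul_act]
    simp)

lemma freeHom_hom {X : V} (Q : Mod V H) (f : X ⟶ Q.X) :
    (freeHom Q f).hom = H ◁ f ≫ act Q := rfl

/-- The action of a module as a morphism of modules `Had ⊗ X ⟶ X`. -/
def actHom (X : Mod V H) : Had H ⊗ X ⟶ X :=
  mkHom (M := Had H ⊗ X) (act X) (tAct_adAct_act (act X) (mul_act X))

lemma actHom_hom (X : Mod V H) : (actHom X).hom = act X := rfl

lemma hom_Had_ext {E : V} {f g : E ⟶ H} (h : f ▷ H ≫ μ[H] = g ▷ H ≫ μ[H]) : f = g := by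
  have key (f : E ⟶ H) : f = (ρ_ E).inv ≫ E ◁ η[H] ≫ f ▷ H ≫ μ[H] := by
    rw [whisker_exchange_assoc, MonObj.mul_one]
    simp
  rw [key f, key g, h]

variable [RightRigidCategory V]

/-- The structure morphisms of the adjoint module as a relative end. -/
noncomputable def adPiHom (X : Mod V H) : Had H ⟶ uHom X X := homEquiv (Had H) X X (actHom X)

lemma adPiHom_hom (X : Mod V H) : (adPiHom X).hom = adPi X := rfl

lemma homEquiv_symm_adPiHom (X : Mod V H) :
    (homEquiv (Had H) X X).symm (adPiHom X) = actHom X :=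
  Equiv.symm_apply_apply _ _

/-- The morphism in `V` underlying the transpose of `π : E ⟶ uHom M M`. -/
noncomputable def actOf {E M : Mod V H} (π : E ⟶ uHom M M) : E.X ⊗ M.X ⟶ M.X :=
  ((homEquiv E M M).symm π).hom

lemma actOf_adPiHom (X : Mod V H) : actOf (adPiHom X) = act X := by
  rw [actOf, homEquiv_symm_adPiHom, actHom_hom]

lemma actOf_hom {E M : Mod V H} (π : E ⟶ uHom M M) :
    tAct (act E) (act M) ≫ actOf π = H ◁ actOf π ≫ act M :=
  act_hom ((homEquiv E M M).symm π)

lemma actOf_precomp {E E' M : Mod V H} (h : E' ⟶ E) (π : E ⟶ uHom M M) :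
    actOf (h ≫ π) = h.hom ▷ M.X ≫ actOf π := by
  rw [actOf, homEquiv_symm_precomp]; rfl

lemma actOf_injective {E M : Mod V H} {π ξ : E ⟶ uHom M M} (h : actOf π = actOf ξ) : π = ξ :=
  (homEquiv E M M).symm.injective (Mod.hom_ext _ _ h)

lemma isRelativeCone_centralFunctor_iff (E : Mod V H) (π : ∀ M : Mod V H, E ⟶ uHom M M) :
    IsRelativeCone (centralFunctor H) (uHomFunctor (Mod V H)) (uPrebalancing (centralFunctor H))
      E π ↔ (∀ {M N : Mod V H} (f : M ⟶ N), actOf (π M) ≫ f.hom = E.X ◁ f.hom ≫ actOf (π N)) ∧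
      ∀ (W : V) (M : Mod V H), actOf (π (triv H W ⊗ M)) =
        (α_ E.X W M.X).inv ≫ (β_ E.X W).hom ▷ M.X ≫ (α_ W E.X M.X).hom ≫ W ◁ actOf (π M) := by
  rw [isRelativeCone_iff]
  have h1 {M N : Mod V H} (f : M ⟶ N) : ((homEquiv E M M).symm (π M) ≫ f =
      E ◁ f ≫ (homEquiv E N N).symm (π N)) ↔
      actOf (π M) ≫ f.hom = E.X ◁ f.hom ≫ actOf (π N) :=
    ⟨fun h => congrArg Mod.Hom.hom h, fun h => Mod.hom_ext _ _ h⟩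
  have h2 (W : V) (M : Mod V H) :
      (E ◁ vEv (centralFunctor H) W M ≫ (homEquiv E M M).symm (π M) =
      E ◁ vAssoc (centralFunctor H) Wᘁ W M ≫ gam (centralFunctor H) E W
        (vAct (centralFunctor H) W M) M ((homEquiv E (vAct (centralFunctor H) W M)
          (vAct (centralFunctor H) W M)).symm (π (vAct (centralFunctor H) W M)))) ↔
      E.X ◁ (ε_ W Wᘁ ▷ M.X ≫ (λ_ M.X).hom) ≫ actOf (π M) =
      E.X ◁ (α_ Wᘁ W M.X).hom ≫ (α_ E.X Wᘁ (W ⊗ M.X)).inv ≫ (β_ E.X Wᘁ).hom ▷ (W ⊗ M.X) ≫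
        (α_ Wᘁ E.X (W ⊗ M.X)).hom ≫ Wᘁ ◁ (show E.X ⊗ (W ⊗ M.X) ⟶ W ⊗ M.X from
          actOf (π (triv H W ⊗ M))) ≫ (α_ Wᘁ W M.X).inv ≫
            ε_ W Wᘁ ▷ M.X ≫ (λ_ M.X).hom := by
    -- The monoidal constraints of the central functor are identities on underlying objects, so only
    -- evaluations and associators of `V` survive.
    have e1 : (vEv (centralFunctor H) W M).hom = ε_ W Wᘁ ▷ M.X ≫ (λ_ M.X).hom := by
      change (ε_ W Wᘁ ≫ 𝟙 (𝟙_ V)) ▷ M.X ≫ (λ_ M.X).hom = _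
      rw [Category.comp_id]
    have e2 : (vAssoc (centralFunctor H) Wᘁ W M).hom = (α_ Wᘁ W M.X).hom := by
      change 𝟙 (Wᘁ ⊗ W) ▷ M.X ≫ (α_ Wᘁ W M.X).hom = _
      rw [id_whiskerRight, Category.id_comp]
    have e3 : (gEv (centralFunctor H) W).hom = ε_ W Wᘁ := by
      change 𝟙 (Wᘁ ⊗ W) ≫ ε_ W Wᘁ ≫ 𝟙 (𝟙_ V) = _
      rw [Category.comp_id, Category.id_comp]
    have k1 : (E ◁ vEv (centralFunctor H) W M ≫ (homEquiv E M M).symm (π M)).hom =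
        E.X ◁ (ε_ W Wᘁ ▷ M.X ≫ (λ_ M.X).hom) ≫ actOf (π M) :=
      congrArg (fun t : (Wᘁ ⊗ W) ⊗ M.X ⟶ M.X => E.X ◁ t ≫ actOf (π M)) e1
    have k2 := congrArg₂ (fun (s : (Wᘁ ⊗ W) ⊗ M.X ⟶ Wᘁ ⊗ (W ⊗ M.X)) (t : Wᘁ ⊗ W ⟶ 𝟙_ V) =>
      E.X ◁ s ≫ (α_ E.X Wᘁ (W ⊗ M.X)).inv ≫ (β_ E.X Wᘁ).hom ▷ (W ⊗ M.X) ≫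
        (α_ Wᘁ E.X (W ⊗ M.X)).hom ≫ Wᘁ ◁ (show E.X ⊗ (W ⊗ M.X) ⟶ W ⊗ M.X from
          actOf (π (triv H W ⊗ M))) ≫ (α_ Wᘁ W M.X).inv ≫ t ▷ M.X ≫ (λ_ M.X).hom) e2 e3
    exact ⟨fun h => k1.symm.trans ((congrArg Mod.Hom.hom h).trans k2),
      fun h => Mod.hom_ext _ _ (k1.trans (h.trans k2.symm))⟩
  constructor
  · exact fun h => ⟨fun f => (h1 f).1 (h.1 f), fun W M =>
      braided_of_relative (W := W) (Y := Wᘁ) _ _ ((h2 W M).1 (h.2 W M))⟩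
  · exact fun h => ⟨fun f => (h1 f).2 (h.1 f), fun W M =>
      (h2 W M).2 (relative_of_braided (W := W) (Y := Wᘁ) _ _ (h.2 W M))⟩

lemma isRelativeCone_adPiHom :
    IsRelativeCone (centralFunctor H) (uHomFunctor (Mod V H)) (uPrebalancing (centralFunctor H))
      (Had H) adPiHom := by
  rw [isRelativeCone_centralFunctor_iff]
  refine ⟨fun f => ?_, fun W M => ?_⟩
  · rw [actOf_adPiHom, actOf_adPiHom]
    exact act_hom f
  · rw [actOf_adPiHom, actOf_adPiHom]
    exact act_triv_tensor W M

/-- The action of a module on a free one, for a family as in the relative end condition,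
is determined by the regular module. -/
lemma actOf_eq_act {E : Mod V H} {π : ∀ M : Mod V H, E ⟶ uHom M M}
    (h : IsRelativeCone (centralFunctor H) (uHomFunctor (Mod V H))
      (uPrebalancing (centralFunctor H)) E π) (M : Mod V H) :
    actOf (π M) = ((ρ_ E.X).inv ≫ E.X ◁ η[H] ≫ actOf (π (regMod H))) ▷ M.X ≫ act M := by
  rw [isRelativeCone_centralFunctor_iff] at h
  obtain ⟨h1, h2⟩ := h
  -- Naturality along the module morphism `M ⊗ H ≅ H ⊗ M ⟶ M`, with `M` trivial and `H` regular in
  -- the source. The relative condition computes the action on the source from that on the regular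
  -- module.
  have e1 := h1 ((trivBraiding M.X (regMod H)).hom ≫ freeHom M (𝟙 M.X))
  rw [h2] at e1
  have e2 : ((trivBraiding M.X (regMod H)).hom ≫ freeHom M (𝟙 M.X)).hom =
      (β_ H M.X).inv ≫ act M := by
    change (β_ H M.X).inv ≫ H ◁ 𝟙 M.X ≫ act M = _
    rw [MonoidalCategory.whiskerLeft_id, Category.id_comp]
  rw [e2] at e1
  obtain ⟨c, hc⟩ : ∃ c : E.X ⊗ H ⟶ H, c = actOf (π (regMod H)) := ⟨_, rfl⟩
  replace e1 : ((α_ E.X M.X H).inv ≫ (β_ E.X M.X).hom ▷ H ≫ (α_ M.X E.X H).hom ≫ M.X ◁ c) ≫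
      (β_ H M.X).inv ≫ act M = E.X ◁ ((β_ H M.X).inv ≫ act M) ≫ actOf (π M) := by
    rw [hc]; exact e1
  change _ = ((ρ_ E.X).inv ≫ E.X ◁ η[H] ≫ (show E.X ⊗ H ⟶ H from
    actOf (π (regMod H)))) ▷ M.X ≫ act M
  rw [show (show E.X ⊗ H ⟶ H from actOf (π (regMod H))) = c from hc.symm]
  -- The unit of `H` splits this morphism in `V`, though not by a module morphism.
  have e3 : (ρ_ M.X).inv ≫ M.X ◁ η[H] ≫ (β_ H M.X).inv ≫ act M = 𝟙 M.X := by
    rw [BraidedCategory.braiding_inv_naturality_right_assoc, one_act, braiding_inv_tensorUnit_left]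
    simp
  calc actOf (π M) = E.X ◁ ((ρ_ M.X).inv ≫ M.X ◁ η[H] ≫ (β_ H M.X).inv ≫ act M) ≫
        actOf (π M) := by
        rw [e3, MonoidalCategory.whiskerLeft_id, Category.id_comp]
    _ = E.X ◁ (ρ_ M.X).inv ≫ E.X ◁ M.X ◁ η[H] ≫
        E.X ◁ ((β_ H M.X).inv ≫ act M) ≫ actOf (π M) := by
        simp only [MonoidalCategory.whiskerLeft_comp, Category.assoc]
    _ = 𝟙 _ ⊗≫ ((E.X ⊗ M.X) ◁ η[H] ≫ (β_ E.X M.X).hom ▷ H) ⊗≫ M.X ◁ c ≫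
        (β_ H M.X).inv ≫ act M := by
        rw [← e1]; monoidal
    _ = (β_ E.X M.X).hom ≫ M.X ◁ ((ρ_ E.X).inv ≫ E.X ◁ η[H] ≫ c) ≫ (β_ H M.X).inv ≫ act M := by
        rw [whisker_exchange]; monoidal
    _ = _ := by
        rw [← BraidedCategory.braiding_naturality_left_assoc, Iso.hom_inv_id_assoc]

/-- The regular module alone separates morphisms: `f` is recovered from `e ⊗ h ↦ f(e) h` at the
unit. -/
lemma hom_ext_adPiHom {E : Mod V H} {f g : E ⟶ Had H}
    (h : ∀ M : Mod V H, f ≫ adPiHom M = g ≫ adPiHom M) : f = g := by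
  apply Mod.hom_ext
  have e := congrArg actOf (h (regMod H))
  rw [actOf_precomp, actOf_precomp, actOf_adPiHom] at e
  exact hom_Had_ext (H := H) (E := E.X) e

lemma existsUnique_of_isRelativeCone {E : Mod V H} {ξ : ∀ M : Mod V H, E ⟶ uHom M M}
    (hξ : IsRelativeCone (centralFunctor H) (uHomFunctor (Mod V H))
      (uPrebalancing (centralFunctor H)) E ξ) :
    ∃! h : E ⟶ Had H, ∀ M : Mod V H, h ≫ adPiHom M = ξ M := by
  have e := actOf_eq_act hξ
  -- Linearity of the action on the regular module, rewritten as `φ(e) h`, is exactly the hypothesis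
  -- of `hom_Had_of` for the action `φ` on the unit.
  have e1 := actOf_hom (ξ (regMod H))
  rw [e] at e1
  let h : E ⟶ Had H := mkHom (N := Had H) ((ρ_ E.X).inv ≫ E.X ◁ η[H] ≫ actOf (ξ (regMod H)))
    (hom_Had_of (act E) _ e1)
  have hh (M : Mod V H) : h ≫ adPiHom M = ξ M := by
    apply actOf_injective
    rw [actOf_precomp, actOf_adPiHom, e M]
    rfl
  exact ⟨h, hh, fun h' hh' => hom_ext_adPiHom fun M => by rw [hh, hh']⟩

lemma isRelativeEnd_adPiHom :
    IsRelativeEnd (centralFunctor H) (uHomFunctor (Mod V H)) (uPrebalancing (centralFunctor H))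
      (Had H) adPiHom where
  toIsRelativeCone := isRelativeCone_adPiHom
  universal _ _ hξ := existsUnique_of_isRelativeCone hξ

end Regular

/-! ### Invertibility of half-braidings that are not assumed invertible -/

section LaxHalfBraiding

universe v₁ u₁
variable {C : Type u₁} [Category.{v₁} C] [MonoidalCategory C]

/-- The inverse of `c Y` is `c X` rotated by the duality. Only the component at the dual `Y` is
obtained, not the one at `X`. -/
lemma isIso_of_exactPairing {A : C} (c : ∀ X : C, A ⊗ X ⟶ X ⊗ A)
    (hc : ∀ {X Y : C} (f : X ⟶ Y), A ◁ f ≫ c Y = c X ≫ f ▷ A)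
    (hc₁ : c (𝟙_ C) = (ρ_ A).hom ≫ (λ_ A).inv)
    (hc₂ : ∀ X Y : C, c (X ⊗ Y) =
      (α_ A X Y).inv ≫ c X ▷ Y ≫ (α_ X A Y).hom ≫ X ◁ c Y ≫ (α_ X Y A).inv)
    (X Y : C) [ExactPairing X Y] : IsIso (c Y) := by
  refine ⟨⟨𝟙 _ ⊗≫ Y ◁ A ◁ η_ X Y ⊗≫ Y ◁ c X ▷ Y ⊗≫ ε_ X Y ▷ (A ⊗ Y) ⊗≫ 𝟙 _, ?_, ?_⟩⟩
  · calc _ = 𝟙 _ ⊗≫ (c Y ▷ 𝟙_ C ≫ (Y ⊗ A) ◁ η_ X Y) ⊗≫ Y ◁ c X ▷ Y ⊗≫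
          ε_ X Y ▷ (A ⊗ Y) ⊗≫ 𝟙 _ := by monoidal
      _ = 𝟙 _ ⊗≫ A ◁ Y ◁ η_ X Y ⊗≫
          ((α_ A Y X).inv ≫ c Y ▷ X ≫ (α_ Y A X).hom ≫ Y ◁ c X ≫ (α_ Y X A).inv) ▷ Y ⊗≫
          ε_ X Y ▷ (A ⊗ Y) ⊗≫ 𝟙 _ := by
          rw [← whisker_exchange]; monoidal
      _ = 𝟙 _ ⊗≫ A ◁ Y ◁ η_ X Y ⊗≫ (c (Y ⊗ X) ≫ ε_ X Y ▷ A) ▷ Y ⊗≫ 𝟙 _ := by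
          rw [← hc₂]; monoidal
      _ = 𝟙 _ ⊗≫ A ◁ (Y ◁ η_ X Y ⊗≫ ε_ X Y ▷ Y) ⊗≫ 𝟙 _ := by
          rw [← hc, hc₁]; monoidal
      _ = _ := by
          rw [ExactPairing.coevaluation_evaluation'']; monoidal
  · calc _ = 𝟙 _ ⊗≫ Y ◁ A ◁ η_ X Y ⊗≫ Y ◁ c X ▷ Y ⊗≫
          (ε_ X Y ▷ (A ⊗ Y) ≫ 𝟙_ C ◁ c Y) ⊗≫ 𝟙 _ := by monoidal
      _ = 𝟙 _ ⊗≫ Y ◁ (A ◁ η_ X Y ≫ (α_ A X Y).inv ≫ c X ▷ Y ≫ (α_ X A Y).hom ≫ X ◁ c Y ≫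
          (α_ X Y A).inv) ⊗≫ ε_ X Y ▷ (Y ⊗ A) ⊗≫ 𝟙 _ := by
          rw [← whisker_exchange]; monoidal
      _ = 𝟙 _ ⊗≫ (Y ◁ η_ X Y ⊗≫ ε_ X Y ▷ Y) ▷ A ⊗≫ 𝟙 _ := by
          rw [← hc₂, hc, hc₁]; monoidal
      _ = _ := by
          rw [ExactPairing.coevaluation_evaluation'']; monoidal

lemma isIso_of_retract {A : C} (c : ∀ X : C, A ⊗ X ⟶ X ⊗ A)
    (hc : ∀ {X Y : C} (f : X ⟶ Y), A ◁ f ≫ c Y = c X ≫ f ▷ A)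
    {X Y : C} (i : X ⟶ Y) (r : Y ⟶ X) (h : i ≫ r = 𝟙 X) [IsIso (c Y)] : IsIso (c X) := by
  refine ⟨⟨i ▷ A ≫ inv (c Y) ≫ A ◁ r, ?_, ?_⟩⟩
  · rw [← reassoc_of% hc i, IsIso.hom_inv_id_assoc, ← MonoidalCategory.whiskerLeft_comp, h,
      MonoidalCategory.whiskerLeft_id]
  · rw [Category.assoc, Category.assoc, hc, IsIso.inv_hom_id_assoc, ← comp_whiskerRight, h,
      id_whiskerRight]

lemma isIso_tensor {A : C} (c : ∀ X : C, A ⊗ X ⟶ X ⊗ A)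
    (hc₂ : ∀ X Y : C, c (X ⊗ Y) =
      (α_ A X Y).inv ≫ c X ▷ Y ≫ (α_ X A Y).hom ≫ X ◁ c Y ≫ (α_ X Y A).inv)
    (X Y : C) [IsIso (c X)] [IsIso (c Y)] : IsIso (c (X ⊗ Y)) := by
  rw [hc₂]
  infer_instance

end LaxHalfBraiding

/-! ### Linearity of `γ` and reduction of its invertibility to free modules -/

section Gamma

variable {V : Type u} [Category.{v} V] [MonoidalCategory V] [BraidedCategory V]
variable {H : V} [HopfObj H]

/-- The morphisms `γ_X : Had ⊗ X ⟶ X ⊗ Had` of modules. -/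
def gammaHom (X : Mod V H) : Had H ⊗ X ⟶ X ⊗ Had H :=
  mkHom (M := Had H ⊗ X) (N := X ⊗ Had H) (gamma (H := H) (act X)) (by
    refine hom_tensor_Had_of (tAct (adAct H) (act X)) (act X) _ ?_
    -- After right multiplication by `H`, `γ_X` becomes the action of `H` on `X ⊗ H` with `H`
    -- regular, and such an action is already known to be linear on the adjoint module.
    have e : gamma (act X) ▷ H ≫ (α_ X.X H H).hom ≫ X.X ◁ μ[H] =
        (α_ H X.X H).hom ≫ tAct (act X) μ[H] := by
      rw [tAct_eq, Iso.hom_inv_id_assoc]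
    rw [e]
    exact act_hom ((α_ (Had H) X (regMod H)).hom ≫ actHom (X ⊗ regMod H)))

lemma gammaHom_naturality {X Y : Mod V H} (f : X ⟶ Y) :
    Had H ◁ f ≫ gammaHom Y = gammaHom X ≫ f ▷ Had H :=
  Mod.hom_ext _ _ (gamma_naturality (H := H) f.hom (act_hom f))

lemma gammaHom_tensor (X Y : Mod V H) : gammaHom (X ⊗ Y) =
    (α_ (Had H) X Y).inv ≫ gammaHom X ▷ Y ≫ (α_ X (Had H) Y).hom ≫ X ◁ gammaHom Y ≫
      (α_ X Y (Had H)).inv :=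
  Mod.hom_ext _ _ (gamma_tAct (H := H) (act X) (act Y))

lemma gammaHom_triv_hom (W : V) : (gammaHom (triv H W)).hom = (β_ H W).hom :=
  gamma_eq_braiding W

lemma gammaHom_unit :
    gammaHom (𝟙_ (Mod V H)) = (ρ_ (Had H)).hom ≫ (λ_ (Had H)).inv := by
  refine Mod.hom_ext _ _ ((gammaHom_triv_hom (𝟙_ V)).trans ?_)
  change (β_ H (𝟙_ V)).hom = (ρ_ H).hom ≫ (λ_ H).inv
  rw [braiding_tensorUnit_right]

lemma isIso_of_isIso_hom {M N : Mod V H} (f : M ⟶ N) (h : IsIso f.hom) : IsIso f :=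
  (mkIso (asIso f.hom) (act_hom f)).isIso_hom

lemma isIso_hom_of_isIso {M N : Mod V H} (f : M ⟶ N) [IsIso f] : IsIso f.hom :=
  ⟨(inv f).hom, congrArg Mod.Hom.hom (IsIso.hom_inv_id f),
    congrArg Mod.Hom.hom (IsIso.inv_hom_id f)⟩

lemma isIso_gammaHom_triv (W : V) : IsIso (gammaHom (triv H W)) :=
  isIso_of_isIso_hom _ (by rw [gammaHom_triv_hom]; exact (β_ H W).isIso_hom)

lemma one_freeHom {X : V} (Q : Mod V H) (f : X ⟶ Q.X) :
    (λ_ X).inv ≫ η[H] ▷ X ≫ (freeHom Q f).hom = f := by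
  rw [freeHom_hom, ← whisker_exchange_assoc, one_act]
  simp

/-- Universal property of the free module: a linear map is determined by its restriction along the
unit of `H`. -/
lemma eq_freeHom {X : V} {Q : Mod V H} (g : regMod H ⊗ triv H X ⟶ Q) :
    g = freeHom Q ((λ_ X).inv ≫ η[H] ▷ X ≫ g.hom) := by
  refine Mod.hom_ext _ _ ?_
  have e := act_hom g
  rw [act_tensor_triv] at e
  obtain ⟨f, hf⟩ : ∃ f : H ⊗ X ⟶ Q.X, f = g.hom := ⟨_, rfl⟩
  replace e : ((α_ H H X).inv ≫ μ[H] ▷ X) ≫ f = H ◁ f ≫ act Q := by rw [hf]; exact e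
  rw [freeHom_hom]
  refine hf.symm.trans ?_
  refine Eq.trans ?_ (congrArg (fun t : H ⊗ X ⟶ Q.X =>
    H ◁ ((λ_ X).inv ≫ η[H] ▷ X ≫ t) ≫ act Q) hf)
  rw [MonoidalCategory.whiskerLeft_comp, MonoidalCategory.whiskerLeft_comp, Category.assoc,
    Category.assoc, ← e, Category.assoc, associator_inv_naturality_middle_assoc,
    ← comp_whiskerRight_assoc, MonObj.mul_one]
  simp

lemma free_ext {X : V} {Q : Mod V H} {f g : regMod H ⊗ triv H X ⟶ Q}
    (h : (λ_ X).inv ≫ η[H] ▷ X ≫ f.hom = (λ_ X).inv ≫ η[H] ▷ X ≫ g.hom) : f = g := by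
  rw [eq_freeHom f, eq_freeHom g, h]

/-- A natural family of morphisms that is invertible on free modules is invertible. -/
lemma isIso_gamma_of_free (h : ∀ Z : V, IsIso (gammaHom (regMod H ⊗ triv H Z))) (X : Mod V H) :
    IsIso (gammaHom X) := by
  let F : V → Mod V H := fun Z => regMod H ⊗ triv H Z
  let s : ∀ Z : V, Z ⟶ (F Z).X := fun Z => (λ_ Z).inv ≫ η[H] ▷ Z
  have hs {Z : V} (Q : Mod V H) (f : Z ⟶ Q.X) : s Z ≫ (freeHom Q f).hom = f := by
    exact (Category.assoc _ _ _).trans (one_freeHom Q f)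
  let c : ∀ M : Mod V H, H ⊗ M.X ⟶ M.X ⊗ H := fun M => gamma (act M)
  have hc {M N : Mod V H} (f : M ⟶ N) : H ◁ f.hom ≫ c N = c M ≫ f.hom ▷ H :=
    gamma_naturality f.hom (act_hom f)
  have hF (Z : V) : IsIso (c (F Z)) := by
    have := h Z
    exact isIso_hom_of_isIso (gammaHom (F Z))
  -- The bar presentation: `p` coequalizes `d₀` and `d₁`, and the units `s` split this coequalizer
  -- in `V`.
  let p : F X.X ⟶ X := freeHom X (𝟙 X.X)
  let d₀ : F (F X.X).X ⟶ F X.X := freeHom (F X.X) (𝟙 (F X.X).X)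
  let d₁ : F (F X.X).X ⟶ F X.X := freeHom (F X.X) (p.hom ≫ s X.X)
  have hp : s X.X ≫ p.hom = 𝟙 X.X := hs X _
  have hd₀ : s (F X.X).X ≫ d₀.hom = 𝟙 _ := hs _ _
  have hd₁ : s (F X.X).X ≫ d₁.hom = p.hom ≫ s X.X := hs _ _
  have hd : d₀.hom ≫ p.hom = d₁.hom ≫ p.hom := by
    have e : d₀ ≫ p = d₁ ≫ p := by
      apply free_ext
      refine (Category.assoc _ _ _).symm.trans (Eq.trans ?_ (Category.assoc _ _ _))
      change s (F X.X).X ≫ d₀.hom ≫ p.hom = s (F X.X).X ≫ d₁.hom ≫ p.hom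
      rw [reassoc_of% hd₀, reassoc_of% hd₁, hp, Category.comp_id]
    exact congrArg Mod.Hom.hom e
  have key {M N : Mod V H} [IsIso (c M)] [IsIso (c N)] (f : M ⟶ N) :
      f.hom ▷ H ≫ inv (c N) = inv (c M) ≫ H ◁ f.hom := by
    rw [IsIso.eq_inv_comp, ← reassoc_of% hc f, IsIso.hom_inv_id, Category.comp_id]
  refine isIso_of_isIso_hom _ (show IsIso (c X) from
    ⟨⟨s X.X ▷ H ≫ inv (c (F X.X)) ≫ H ◁ p.hom, ?_, ?_⟩⟩)
  -- It suffices to check after the split epimorphism `H ◁ p.hom`. There `p.hom ≫ s` is traded for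
  -- `d₁`, naturality of the inverses on free modules applies, and `d₁` is exchanged for `d₀`, which
  -- `s` splits.
  · have : IsSplitEpi (H ◁ p.hom) := ⟨⟨⟨H ◁ s X.X, by
      rw [← MonoidalCategory.whiskerLeft_comp, hp, MonoidalCategory.whiskerLeft_id]⟩⟩⟩
    rw [← cancel_epi (H ◁ p.hom), reassoc_of% hc p, ← comp_whiskerRight_assoc, ← hd₁,
      comp_whiskerRight_assoc, reassoc_of% key d₁, ← MonoidalCategory.whiskerLeft_comp, ← hd,
      MonoidalCategory.whiskerLeft_comp, ← reassoc_of% key d₀, ← comp_whiskerRight_assoc, hd₀,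
      id_whiskerRight, Category.id_comp, IsIso.hom_inv_id_assoc, Category.comp_id]
  · rw [Category.assoc, Category.assoc, hc, IsIso.inv_hom_id_assoc, ← comp_whiskerRight, hp,
      id_whiskerRight]

end Gamma

/-! ### The dual of a comonoid as a comodule -/

section DualComodule

universe v₁ u₁
variable {C : Type u₁} [Category.{v₁} C] [MonoidalCategory C] [RightRigidCategory C]

/-- The morphism `f ⊗ x ↦ f(x₁) x₂` of a comonoid. -/
def evComul (R : C) [ComonObj R] : Rᘁ ⊗ R ⟶ R :=
  Rᘁ ◁ Δ[R] ≫ (α_ Rᘁ R R).inv ≫ ε_ R Rᘁ ▷ R ≫ (λ_ R).hom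

/-- The coaction of a comonoid on its dual. -/
def dualCoact (R : C) [ComonObj R] : Rᘁ ⟶ R ⊗ Rᘁ := homEquiv Rᘁ R R (evComul R)

lemma homEquiv_symm_dualCoact (R : C) [ComonObj R] :
    (homEquiv Rᘁ R R).symm (dualCoact R) = evComul R :=
  Equiv.symm_apply_apply _ _

lemma evComul_counit (R : C) [ComonObj R] : evComul R ≫ ε[R] = ε_ R Rᘁ := by
  calc _ = Rᘁ ◁ Δ[R] ⊗≫ (ε_ R Rᘁ ▷ R ≫ 𝟙_ C ◁ ε[R]) ⊗≫ 𝟙 _ := by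
        rw [evComul]; monoidal
    _ = Rᘁ ◁ (Δ[R] ≫ R ◁ ε[R]) ⊗≫ ε_ R Rᘁ := by
        rw [← whisker_exchange]; monoidal
    _ = _ := by
        rw [ComonObj.comul_counit]; monoidal

lemma evComul_comul (R : C) [ComonObj R] : evComul R ≫ Δ[R] =
    Rᘁ ◁ Δ[R] ≫ (α_ Rᘁ R R).inv ≫ evComul R ▷ R := by
  calc _ = Rᘁ ◁ Δ[R] ⊗≫ (ε_ R Rᘁ ▷ R ≫ 𝟙_ C ◁ Δ[R]) ⊗≫ 𝟙 _ := by
        rw [evComul]; monoidal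
    _ = Rᘁ ◁ (Δ[R] ≫ R ◁ Δ[R]) ⊗≫ ε_ R Rᘁ ▷ (R ⊗ R) ⊗≫ 𝟙 _ := by
        rw [← whisker_exchange]; monoidal
    _ = _ := by
        rw [ComonObj.comul_assoc, evComul]; monoidal

lemma dualCoact_counit (R : C) [ComonObj R] :
    dualCoact R ≫ ε[R] ▷ Rᘁ ≫ (λ_ Rᘁ).hom = 𝟙 Rᘁ := by
  rw [← Category.assoc, ← Iso.eq_comp_inv, Category.id_comp]
  apply (homEquiv Rᘁ R (𝟙_ C)).symm.injective
  rw [homEquiv_symm_postcomp, homEquiv_symm_dualCoact, evComul_counit, homEquiv_symm_apply]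
  monoidal

/-- Transposed to `Rᘁ ⊗ R`, the iterated coaction is `f ⊗ x ↦ f(x₁) x₂ ⊗ x₃`, and the claim becomes
`evComul_comul`. -/
lemma dualCoact_coassoc (R : C) [ComonObj R] :
    dualCoact R ≫ Δ[R] ▷ Rᘁ ≫ (α_ R R Rᘁ).hom = dualCoact R ≫ R ◁ dualCoact R := by
  rw [← Category.assoc, ← Iso.eq_comp_inv]
  apply (homEquiv Rᘁ R (R ⊗ R)).symm.injective
  rw [homEquiv_symm_postcomp, homEquiv_symm_dualCoact, evComul_comul]
  symm
  have e := homEquiv_symm_dualCoact R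
  rw [homEquiv_symm_apply] at e
  calc _ = dualCoact R ▷ R ≫ (α_ R Rᘁ R).hom ≫
        R ◁ (dualCoact R ▷ R ≫ (α_ R Rᘁ R).hom ≫ R ◁ ε_ R Rᘁ ≫ (ρ_ R).hom) := by
        rw [homEquiv_symm_apply]; monoidal
    _ = 𝟙 _ ⊗≫ (dualCoact R ▷ R ≫ (R ⊗ Rᘁ) ◁ Δ[R]) ⊗≫ R ◁ ε_ R Rᘁ ▷ R ⊗≫ 𝟙 _ := by
        rw [e, evComul]; monoidal
    _ = Rᘁ ◁ Δ[R] ⊗≫ (dualCoact R ▷ R ≫ (α_ R Rᘁ R).hom ≫ R ◁ ε_ R Rᘁ ≫ (ρ_ R).hom) ▷ R := by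
        rw [← whisker_exchange]; monoidal
    _ = _ := by
        rw [e]; monoidal

end DualComodule

/-! ### Hopf modules and their coinvariants -/

section HopfModule

variable {V : Type u} [Category.{v} V] [MonoidalCategory V] [BraidedCategory V]
variable {H : V} [HopfObj H]

lemma one_gamma_mul : H ◁ η[H] ≫ gamma μ[H] = (ρ_ H).hom ≫ Δ[H] := by
  calc _ = (H ◁ η[H] ≫ Δ[H] ▷ H) ⊗≫ H ◁ (β_ H H).hom ⊗≫ μ[H] ▷ H := by
        rw [gamma]; monoidal
    _ = Δ[H] ▷ 𝟙_ V ⊗≫ H ◁ (H ◁ η[H] ≫ (β_ H H).hom) ⊗≫ μ[H] ▷ H := by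
        rw [whisker_exchange]; monoidal
    _ = 𝟙 _ ⊗≫ Δ[H] ⊗≫ (H ◁ η[H] ≫ μ[H]) ▷ H := by
        rw [BraidedCategory.braiding_naturality_right, braiding_tensorUnit_right]; monoidal
    _ = _ := by
        rw [MonObj.mul_one]; monoidal

/-- The morphism `h ⊗ n ↦ h₁ ⊗ h₂ n`. -/
def fusion {N : V} (a : H ⊗ N ⟶ N) : H ⊗ N ⟶ H ⊗ N :=
  Δ[H] ▷ N ≫ (α_ H H N).hom ≫ H ◁ a

/-- Exhibits `fusion a` as the map on a free module generated by `n ↦ 1 ⊗ n`, which is why it is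
linear. -/
lemma one_tAct_mul {N : V} (a : H ⊗ N ⟶ N) :
    H ◁ ((λ_ N).inv ≫ η[H] ▷ N) ≫ tAct μ[H] a = fusion a := by
  calc _ = 𝟙 _ ⊗≫ (H ◁ η[H] ≫ gamma μ[H]) ▷ N ⊗≫ H ◁ a := by
        rw [tAct_eq]; monoidal
    _ = _ := by
        rw [one_gamma_mul, fusion]; monoidal

/-- The composite is `h ⊗ n ↦ h₁ ⊗ f(h₂) g(h₃) n`. Taking the antipode for `f` or for `g`, and the
identity for the other, gives the two inverse laws. -/
lemma fusion_inv_aux {N : V} (a : H ⊗ N ⟶ N)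
    (ha : μ[H] ▷ N ≫ a = (α_ H H N).hom ≫ H ◁ a ≫ a)
    (ha₁ : η[H] ▷ N ≫ a = (λ_ N).hom) (f g : H ⟶ H) (h : Δ[H] ≫ f ▷ H ≫ H ◁ g ≫ μ[H] = ε[H] ≫ η[H]) :
    (Δ[H] ▷ N ≫ (α_ H H N).hom ≫ H ◁ (g ▷ N ≫ a)) ≫
      (Δ[H] ▷ N ≫ (α_ H H N).hom ≫ H ◁ (f ▷ N ≫ a)) = 𝟙 (H ⊗ N) := by
  calc _ = Δ[H] ▷ N ⊗≫ (H ◁ (g ▷ N ≫ a) ≫ Δ[H] ▷ N) ⊗≫ H ◁ (f ▷ N ≫ a) := by monoidal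
    _ = (Δ[H] ≫ Δ[H] ▷ H ≫ (α_ H H H).hom) ▷ N ⊗≫ H ◁ H ◁ g ▷ N ⊗≫
        H ◁ (H ◁ a ≫ f ▷ N) ⊗≫ H ◁ a := by
        rw [whisker_exchange]; monoidal
    _ = (Δ[H] ≫ H ◁ Δ[H]) ▷ N ⊗≫ H ◁ (H ◁ g ≫ f ▷ H) ▷ N ⊗≫
        H ◁ ((α_ H H N).hom ≫ H ◁ a ≫ a) := by
        rw [← ComonObj.comul_assoc, whisker_exchange]; monoidal
    _ = Δ[H] ▷ N ⊗≫ H ◁ (Δ[H] ≫ f ▷ H ≫ H ◁ g ≫ μ[H]) ▷ N ⊗≫ H ◁ a := by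
        rw [← ha, whisker_exchange]; monoidal
    _ = (Δ[H] ≫ H ◁ ε[H]) ▷ N ⊗≫ H ◁ (η[H] ▷ N ≫ a) := by
        rw [h]; monoidal
    _ = _ := by
        rw [ComonObj.comul_counit, ha₁]; monoidal

/-- The isomorphism `h ⊗ n ↦ h₁ ⊗ h₂ n`, with inverse `h ⊗ n ↦ h₁ ⊗ S(h₂) n`. -/
def fusionIso (N : Mod V H) : H ⊗ N.X ≅ H ⊗ N.X where
  hom := fusion (act N)
  inv := Δ[H] ▷ N.X ≫ (α_ H H N.X).hom ≫ H ◁ (HopfObj.antipode ▷ N.X ≫ act N)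
  hom_inv_id := by
    have e := fusion_inv_aux (act N) (mul_act N) (one_act N) HopfObj.antipode (𝟙 H)
      (by rw [MonoidalCategory.whiskerLeft_id, Category.id_comp, HopfObj.antipode_left])
    rwa [id_whiskerRight, Category.id_comp] at e
  inv_hom_id := by
    have e := fusion_inv_aux (act N) (mul_act N) (one_act N) (𝟙 H) HopfObj.antipode
      (by rw [id_whiskerRight, Category.id_comp, HopfObj.antipode_right])
    rwa [id_whiskerRight, Category.id_comp] at e

/-- A free module is isomorphic to the tensor product of the regular module and a module. -/
def freeIso (N : Mod V H) : regMod H ⊗ triv H N.X ≅ regMod H ⊗ N :=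
  mkIso (M := regMod H ⊗ triv H N.X) (N := regMod H ⊗ N) (fusionIso N) (by
    have e := one_tAct_mul (act N)
    change _ ≫ fusion (act N) = H ◁ fusion (act N) ≫ _
    rw [← e]
    exact act_hom (freeHom (regMod H ⊗ N) ((λ_ N.X).inv ≫ η[H] ▷ N.X)))

/-- The projection `n ↦ S(n₋₁) n₀` of a Hopf module. -/
def coinvProj {N : V} (a : H ⊗ N ⟶ N) (d : N ⟶ H ⊗ N) : N ⟶ N :=
  d ≫ HopfObj.antipode ▷ N ≫ a

/-- `n₋₂ S(n₋₁) n₀ = n`: a Hopf module is generated by its coinvariants. -/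
lemma coinvProj_act {N : Mod V H} {d : N.X ⟶ H ⊗ N.X}
    (d_counit : d ≫ ε[H] ▷ N.X ≫ (λ_ N.X).hom = 𝟙 N.X)
    (d_coassoc : d ≫ Δ[H] ▷ N.X ≫ (α_ H H N.X).hom = d ≫ H ◁ d) :
    d ≫ H ◁ coinvProj (act N) d ≫ act N = 𝟙 N.X := by
  calc _ = (d ≫ H ◁ d) ≫ H ◁ HopfObj.antipode ▷ N.X ≫ H ◁ act N ≫ act N := by
        rw [coinvProj]; simp
    _ = d ⊗≫ Δ[H] ▷ N.X ⊗≫ H ◁ HopfObj.antipode (X := H) ▷ N.X ⊗≫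
        ((α_ H H N.X).hom ≫ H ◁ act N ≫ act N) := by
        rw [← d_coassoc]; monoidal
    _ = d ⊗≫ (Δ[H] ≫ H ◁ HopfObj.antipode ≫ μ[H]) ▷ N.X ⊗≫ act N := by
        rw [← mul_act]; monoidal
    _ = d ⊗≫ ε[H] ▷ N.X ⊗≫ (η[H] ▷ N.X ≫ act N) := by
        rw [HopfObj.antipode_right]; monoidal
    _ = _ := by
        rw [one_act, ← d_counit]; monoidal

/-- A morphism `F` is determined by `n ↦ n₋₁ F(n₀)`. -/
lemma coact_act_cancel {N : Mod V H} {d : N.X ⟶ H ⊗ N.X}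
    (d_counit : d ≫ ε[H] ▷ N.X ≫ (λ_ N.X).hom = 𝟙 N.X)
    (d_coassoc : d ≫ Δ[H] ▷ N.X ≫ (α_ H H N.X).hom = d ≫ H ◁ d)
    {Q : Mod V H} {f g : N.X ⟶ Q.X}
    (h : d ≫ H ◁ f ≫ act Q = d ≫ H ◁ g ≫ act Q) : f = g := by
  -- `S(n₋₂) n₋₁ f(n₀) = f(n)`.
  have key (f : N.X ⟶ Q.X) :
      d ≫ H ◁ (d ≫ H ◁ f ≫ act Q) ≫ HopfObj.antipode ▷ Q.X ≫ act Q = f := by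
    calc _ = (d ≫ H ◁ d) ⊗≫ H ◁ H ◁ f ⊗≫ (H ◁ act Q ≫ HopfObj.antipode ▷ Q.X) ≫ act Q := by
          monoidal
      _ = d ⊗≫ Δ[H] ▷ N.X ⊗≫ ((H ⊗ H) ◁ f ≫ HopfObj.antipode (X := H) ▷ H ▷ Q.X) ⊗≫
          ((α_ H H Q.X).hom ≫ H ◁ act Q ≫ act Q) := by
          rw [← d_coassoc, whisker_exchange]; monoidal
      _ = d ⊗≫ (Δ[H] ≫ HopfObj.antipode ▷ H) ▷ N.X ⊗≫ ((H ⊗ H) ◁ f ≫ μ[H] ▷ Q.X) ≫ act Q := by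
          rw [← mul_act]
          have e := whisker_exchange (HopfObj.antipode (X := H) ▷ H) f
          rw [e]; monoidal
      _ = d ⊗≫ (Δ[H] ≫ HopfObj.antipode ▷ H ≫ μ[H]) ▷ N.X ⊗≫ H ◁ f ≫ act Q := by
          rw [whisker_exchange]; monoidal
      _ = d ⊗≫ ε[H] ▷ N.X ⊗≫ (η[H] ▷ N.X ≫ H ◁ f) ≫ act Q := by
          rw [HopfObj.antipode_left]; monoidal
      _ = (d ≫ ε[H] ▷ N.X ≫ (λ_ N.X).hom) ≫ f := by
          rw [← whisker_exchange, Category.assoc, one_act]; monoidal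
      _ = f := by
          rw [d_counit, Category.id_comp]
  rw [← key f, ← key g, h]

/-- The projection lands in the coinvariants. By `coact_act_cancel` it is enough to compare after
acting by `n₋₁`, where both sides give `n₋₁ ⊗ n₀`; this avoids the compatibility of the antipode
with the comultiplication. -/
lemma coinvProj_coact {N : Mod V H} {d : N.X ⟶ H ⊗ N.X}
    (d_counit : d ≫ ε[H] ▷ N.X ≫ (λ_ N.X).hom = 𝟙 N.X)
    (d_coassoc : d ≫ Δ[H] ▷ N.X ≫ (α_ H H N.X).hom = d ≫ H ◁ d)
    (hd : act N ≫ d = H ◁ d ≫ tAct μ[H] (act N)) :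
    coinvProj (act N) d ≫ d = coinvProj (act N) d ≫ (λ_ N.X).inv ≫ η[H] ▷ N.X := by
  refine coact_act_cancel d_counit d_coassoc (Q := regMod H ⊗ N) ?_
  change d ≫ H ◁ (coinvProj (act N) d ≫ d) ≫ tAct μ[H] (act N) =
    d ≫ H ◁ (coinvProj (act N) d ≫ (λ_ N.X).inv ≫ η[H] ▷ N.X) ≫ tAct μ[H] (act N)
  have e := coinvProj_act d_counit d_coassoc
  have e1 := one_tAct_mul (act N)
  rw [MonoidalCategory.whiskerLeft_comp, MonoidalCategory.whiskerLeft_comp, Category.assoc,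
    Category.assoc, ← hd, reassoc_of% e, e1, fusion, whisker_exchange_assoc]
  symm
  calc _ = (d ≫ Δ[H] ▷ N.X ≫ (α_ H H N.X).hom) ⊗≫ H ◁ (H ◁ coinvProj (act N) d ≫ act N) := by
        monoidal
    _ = d ≫ H ◁ (d ≫ H ◁ coinvProj (act N) d ≫ act N) := by
        rw [d_coassoc]; monoidal
    _ = d := by
        rw [e, MonoidalCategory.whiskerLeft_id, Category.comp_id]

/-- On a coinvariant the coaction is `1 ⊗ n`, and `fusion` fixes `1 ⊗ n` because the unit is
grouplike. -/
lemma coinvProj_fusion_inv {N : Mod V H} {d : N.X ⟶ H ⊗ N.X}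
    (d_counit : d ≫ ε[H] ▷ N.X ≫ (λ_ N.X).hom = 𝟙 N.X)
    (d_coassoc : d ≫ Δ[H] ▷ N.X ≫ (α_ H H N.X).hom = d ≫ H ◁ d)
    (hd : act N ≫ d = H ◁ d ≫ tAct μ[H] (act N)) :
    coinvProj (act N) d ≫ d ≫ (fusionIso N).inv =
      coinvProj (act N) d ≫ (λ_ N.X).inv ≫ η[H] ▷ N.X := by
  have e := coinvProj_coact d_counit d_coassoc hd
  rw [reassoc_of% e, ← Category.assoc, ← Category.assoc, Iso.comp_inv_eq]
  change _ = _ ≫ Δ[H] ▷ N.X ≫ (α_ H H N.X).hom ≫ H ◁ act N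
  simp only [Category.assoc]
  rw [← comp_whiskerRight_assoc, Bimon.one_comul]
  symm
  calc _ = coinvProj (act N) d ⊗≫ η[H] ▷ N.X ⊗≫ H ◁ (η[H] ▷ N.X ≫ act N) := by
        rw [MonoidalCategory.tensorHom_def]; monoidal
    _ = _ := by
        rw [one_act]; monoidal

end HopfModule

/-! ### The regular module as a retract, and invertibility of `γ` -/

section Invertible

variable {V : Type u} [Category.{v} V] [MonoidalCategory V] [BraidedCategory V]
variable {H : V} [HopfObj H]

/-- The regular module is a coalgebra in the category of modules. -/
instance : ComonObj (regMod H) where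
  counit := mkHom (M := regMod H) (N := 𝟙_ (Mod V H)) ε[H] (by
    change μ[H] ≫ ε[H] = H ◁ ε[H] ≫ ε[H] ▷ 𝟙_ V ≫ (λ_ (𝟙_ V)).hom
    rw [Bimon.mul_counit, MonoidalCategory.tensorHom_def'_assoc])
  comul := mkHom (M := regMod H) (N := regMod H ⊗ regMod H) Δ[H] (by
    change μ[H] ≫ Δ[H] = H ◁ Δ[H] ≫ Δ[H] ▷ (H ⊗ H) ≫ tensorμ H H H H ≫ (μ[H] ⊗ₘ μ[H])
    rw [BimonObj.mul_comul, MonoidalCategory.tensorHom_def'_assoc])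
  counit_comul := Mod.hom_ext _ _ (ComonObj.counit_comul H)
  comul_counit := Mod.hom_ext _ _ (ComonObj.comul_counit H)
  comul_assoc := Mod.hom_ext _ _ (ComonObj.comul_assoc H)

/-- A Hopf module yields the regular module as a retract of its multiples, if a multiple of its
projection has the unit as a retract. -/
lemma exists_retract_of_coinvProj {N : Mod V H} (δ : N ⟶ regMod H ⊗ N) {d : N.X ⟶ H ⊗ N.X}
    (hδ : δ.hom = d)
    (d_counit : d ≫ ε[H] ▷ N.X ≫ (λ_ N.X).hom = 𝟙 N.X)
    (d_coassoc : d ≫ Δ[H] ▷ N.X ≫ (α_ H H N.X).hom = d ≫ H ◁ d)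
    {K : V} (a : 𝟙_ V ⟶ K ⊗ N.X) (b : K ⊗ N.X ⟶ 𝟙_ V)
    (hab : a ≫ K ◁ coinvProj (act N) d ≫ b = 𝟙 (𝟙_ V)) :
    ∃ (i : regMod H ⊗ triv H (𝟙_ V) ⟶ triv H K ⊗ N)
      (r : triv H K ⊗ N ⟶ regMod H ⊗ triv H (𝟙_ V)), i ≫ r = 𝟙 _ := by
  have hd : act N ≫ d = H ◁ d ≫ tAct μ[H] (act N) := by
    rw [← hδ]; exact act_hom δ
  let p : N.X ⟶ N.X := coinvProj (act N) d
  have hj : p ≫ d ≫ (fusionIso N).inv = p ≫ (λ_ N.X).inv ≫ η[H] ▷ N.X :=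
    coinvProj_fusion_inv d_counit d_coassoc hd
  let i : regMod H ⊗ triv H (𝟙_ V) ⟶ triv H K ⊗ N :=
    freeHom (X := 𝟙_ V) (triv H K ⊗ N) (a ≫ K ◁ p)
  -- The map `n ↦ n₋₁ ⊗ S(n₋₂) n₀`-type decomposition of a Hopf module is realized as the coaction
  -- followed by the inverse of `freeIso N`; `b` then kills the trivial factor. The idempotent `p`
  -- need not split.
  let r : triv H K ⊗ N ⟶ regMod H ⊗ triv H (𝟙_ V) :=
    triv H K ◁ (δ ≫ (freeIso N).inv) ≫ (α_ (triv H K) (regMod H) (triv H N.X)).inv ≫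
      (trivBraiding K (regMod H)).hom ▷ triv H N.X ≫
      (α_ (regMod H) (triv H K) (triv H N.X)).hom ≫
      regMod H ◁ ((centralTensorIso H K N.X).hom ≫ (centralFunctor H).map b).f
  have hi : (λ_ (𝟙_ V)).inv ≫ η[H] ▷ 𝟙_ V ≫ i.hom = a ≫ K ◁ p :=
    one_freeHom (X := 𝟙_ V) (triv H K ⊗ N) (a ≫ K ◁ p)
  have hr : r.hom = K ◁ (d ≫ (fusionIso N).inv) ≫ (α_ K H N.X).inv ≫ (β_ H K).inv ▷ N.X ≫
      (α_ H K N.X).hom ≫ H ◁ (𝟙 (K ⊗ N.X) ≫ b) := by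
    rw [← hδ]; rfl
  refine ⟨i, r, free_ext ?_⟩
  change (λ_ (𝟙_ V)).inv ≫ η[H] ▷ 𝟙_ V ≫ i.hom ≫ r.hom =
    (λ_ (𝟙_ V)).inv ≫ η[H] ▷ 𝟙_ V ≫ 𝟙 (H ⊗ 𝟙_ V)
  have e : (λ_ (𝟙_ V)).inv ≫ η[H] ▷ 𝟙_ V ≫ i.hom ≫ r.hom = (a ≫ K ◁ p) ≫ r.hom := by
    rw [← hi]
    exact (Category.assoc (λ_ (𝟙_ V)).inv (η[H] ▷ 𝟙_ V) (i.hom ≫ r.hom)).symm.trans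
      ((Category.assoc ((λ_ (𝟙_ V)).inv ≫ η[H] ▷ 𝟙_ V) i.hom r.hom).symm.trans
        (congrArg (· ≫ r.hom) (Category.assoc (λ_ (𝟙_ V)).inv (η[H] ▷ 𝟙_ V) i.hom)))
  refine e.trans ?_
  rw [hr]
  calc (a ≫ K ◁ p) ≫ K ◁ (d ≫ (fusionIso N).inv) ≫ (α_ K H N.X).inv ≫ (β_ H K).inv ▷ N.X ≫
        (α_ H K N.X).hom ≫ H ◁ (𝟙 (K ⊗ N.X) ≫ b) =
      a ≫ K ◁ (p ≫ d ≫ (fusionIso N).inv) ≫ (α_ K H N.X).inv ≫ (β_ H K).inv ▷ N.X ≫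
        (α_ H K N.X).hom ≫ H ◁ b := by
        simp only [Category.assoc, MonoidalCategory.whiskerLeft_comp, Category.id_comp]
    _ = a ≫ K ◁ p ⊗≫ (K ◁ η[H] ≫ (β_ H K).inv) ▷ N.X ⊗≫ H ◁ b := by
        rw [hj]; monoidal
    _ = a ≫ K ◁ p ⊗≫ (η[H] ▷ (K ⊗ N.X) ≫ H ◁ b) := by
        rw [BraidedCategory.braiding_inv_naturality_right, braiding_inv_tensorUnit_left]; monoidal
    _ = (a ≫ K ◁ p ≫ b) ≫ (λ_ (𝟙_ V)).inv ≫ η[H] ▷ 𝟙_ V := by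
        rw [← whisker_exchange]; monoidal
    _ = _ := by
        rw [hab]; simp

variable [RightRigidCategory V]

lemma exists_retract_dual :
    ∃ (i : regMod H ⊗ triv H (𝟙_ V) ⟶ triv H H ⊗ (regMod H)ᘁ)
      (r : triv H H ⊗ (regMod H)ᘁ ⟶ regMod H ⊗ triv H (𝟙_ V)), i ≫ r = 𝟙 _ := by
  let N : Mod V H := (regMod H)ᘁ
  let ev : Hᘁ ⊗ H ⟶ 𝟙_ V := ε_ H Hᘁ
  let d : Hᘁ ⟶ H ⊗ Hᘁ := (dualCoact (regMod H)).hom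
  have d_counit : d ≫ ε[H] ▷ Hᘁ ≫ (λ_ Hᘁ).hom = 𝟙 Hᘁ :=
    congrArg Mod.Hom.hom (dualCoact_counit (regMod H))
  have d_coassoc : d ≫ Δ[H] ▷ Hᘁ ≫ (α_ H H Hᘁ).hom = d ≫ H ◁ d :=
    congrArg Mod.Hom.hom (dualCoact_coassoc (regMod H))
  -- The counit of `H`, viewed as an element of the dual.
  let c : 𝟙_ V ⟶ Hᘁ := homEquiv (𝟙_ V) H (𝟙_ V) ((λ_ H).hom ≫ ε[H]) ≫ (λ_ Hᘁ).hom
  have hc : c ▷ H ≫ ev = (λ_ H).hom ≫ ε[H] := by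
    have e := (homEquiv (𝟙_ V) H (𝟙_ V)).symm_apply_apply ((λ_ H).hom ≫ ε[H])
    rw [homEquiv_symm_apply] at e
    rw [← e]
    simp only [c, ev]
    monoidal
  let n : H ⊗ Hᘁ ⟶ Hᘁ := act N
  have hp : d ≫ H ◁ coinvProj n d ≫ n = 𝟙 Hᘁ := coinvProj_act (N := N) d_counit d_coassoc
  -- `a` is the coaction on the counit; `b` acts by `H` and evaluates at the unit. By
  -- `coinvProj_act` the composite collapses to `ε(1) = 1`.
  refine exists_retract_of_coinvProj (N := N) (dualCoact (regMod H)) rfl d_counit d_coassoc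
    (K := H) (c ≫ d) (n ≫ (ρ_ Hᘁ).inv ≫ Hᘁ ◁ η[H] ≫ ev) ?_
  change (c ≫ d) ≫ H ◁ coinvProj n d ≫ n ≫ (ρ_ Hᘁ).inv ≫ Hᘁ ◁ η[H] ≫ ev = _
  rw [Category.assoc, reassoc_of% hp, rightUnitor_inv_naturality_assoc, ← whisker_exchange_assoc,
    hc, leftUnitor_naturality_assoc, BimonObj.one_counit]
  monoidal

lemma isIso_gammaHom (X : Mod V H) : IsIso (gammaHom X) := by
  have : IsIso (gammaHom (regMod H)ᘁ) :=
    isIso_of_exactPairing gammaHom gammaHom_naturality gammaHom_unit gammaHom_tensor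
      (regMod H) (regMod H)ᘁ
  have := isIso_gammaHom_triv (H := H) H
  have : IsIso (gammaHom (triv H H ⊗ (regMod H)ᘁ)) :=
    isIso_tensor gammaHom gammaHom_tensor _ _
  obtain ⟨i, r, h⟩ := exists_retract_dual (H := H)
  have : IsIso (gammaHom (regMod H)) :=
    isIso_of_retract gammaHom gammaHom_naturality ((ρ_ (regMod H)).inv ≫ i)
      (r ≫ (ρ_ (regMod H)).hom) (by
        rw [Category.assoc, reassoc_of% h]
        exact (ρ_ (regMod H)).inv_hom_id)
  refine isIso_gamma_of_free (fun Z => ?_) X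
  have := isIso_gammaHom_triv (H := H) Z
  exact isIso_tensor gammaHom gammaHom_tensor _ _

end Invertible

/-! ### The adjoint algebra in the center -/

section Algebra

variable {V : Type u} [Category.{v} V] [MonoidalCategory V] [BraidedCategory V]
variable (H : V) [HopfObj H]

/-- Acting on the regular module by a product is acting twice, a composite of module morphisms. -/
lemma mul_hom_Had : tAct (adAct H) (adAct H) ≫ μ[H] = H ◁ μ[H] ≫ adAct H := by
  refine hom_Had_of _ _ ?_
  rw [MonObj.mul_assoc]
  exact act_hom ((α_ (Had H) (Had H) (regMod H)).hom ≫ Had H ◁ actHom (regMod H) ≫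
    actHom (regMod H))

lemma one_hom_Had : (ε[H] ▷ 𝟙_ V ≫ (λ_ (𝟙_ V)).hom) ≫ η[H] = H ◁ η[H] ≫ adAct H := by
  refine hom_Had_of _ _ ?_
  rw [MonObj.one_mul]
  exact act_hom (λ_ (regMod H)).hom

variable {H}

/-- Tested by right multiplication with `H`, where `γ` becomes the action on `X ⊗ H`; the claim is
then associativity of that action. -/
lemma gamma_mul {X : V} (a : H ⊗ X ⟶ X)
    (ha : μ[H] ▷ (X ⊗ H) ≫ tAct a μ[H] =
      (α_ H H (X ⊗ H)).hom ≫ H ◁ tAct a μ[H] ≫ tAct a μ[H]) :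
    μ[H] ▷ X ≫ gamma a = ((α_ H H X).hom ≫ H ◁ gamma a ≫ (α_ H X H).inv ≫ gamma a ▷ H ≫
      (α_ X H H).hom) ≫ X ◁ μ[H] := by
  have e : gamma a ▷ H ≫ (α_ X H H).hom ≫ X ◁ μ[H] = (α_ H X H).hom ≫ tAct a μ[H] := by
    rw [tAct_eq, Iso.hom_inv_id_assoc]
  apply ext_mul
  calc _ = μ[H] ▷ X ▷ H ≫ (α_ H X H).hom ≫ tAct a μ[H] := by
        rw [← e]; simp
    _ = 𝟙 _ ⊗≫ H ◁ ((α_ H X H).hom ≫ tAct a μ[H]) ≫ tAct a μ[H] := by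
        rw [associator_naturality_left_assoc, ha]; monoidal
    _ = 𝟙 _ ⊗≫ H ◁ gamma a ▷ H ⊗≫ (H ⊗ X) ◁ μ[H] ⊗≫ tAct a μ[H] := by
        rw [← e]; monoidal
    _ = 𝟙 _ ⊗≫ H ◁ gamma a ▷ H ⊗≫ ((H ⊗ X) ◁ μ[H] ≫ gamma a ▷ H) ⊗≫ X ◁ μ[H] := by
        rw [tAct_eq]; monoidal
    _ = 𝟙 _ ⊗≫ H ◁ gamma a ▷ H ⊗≫ gamma a ▷ (H ⊗ H) ⊗≫ X ◁ (H ◁ μ[H] ≫ μ[H]) := by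
        rw [whisker_exchange]; monoidal
    _ = _ := by
        rw [MonObj.mul_assoc_flip]; monoidal

lemma gamma_one {X : V} (a : H ⊗ X ⟶ X) (ha : η[H] ▷ (X ⊗ H) ≫ tAct a μ[H] = (λ_ (X ⊗ H)).hom) :
    η[H] ▷ X ≫ gamma a = ((λ_ X).hom ≫ (ρ_ X).inv) ≫ X ◁ η[H] := by
  have e : gamma a ▷ H ≫ (α_ X H H).hom ≫ X ◁ μ[H] = (α_ H X H).hom ≫ tAct a μ[H] := by
    rw [tAct_eq, Iso.hom_inv_id_assoc]
  apply ext_mul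
  calc _ = η[H] ▷ X ▷ H ≫ (α_ H X H).hom ≫ tAct a μ[H] := by
        rw [← e]; simp
    _ = 𝟙 _ ⊗≫ X ◁ (λ_ H).hom := by
        rw [associator_naturality_left_assoc, ha]; monoidal
    _ = _ := by
        rw [← MonObj.one_mul]; monoidal

variable [RightRigidCategory V] (H)

/-- The half-braiding on the adjoint module. -/
noncomputable def adHalfBraiding : HalfBraiding (Had H) where
  β X := @asIso _ _ _ _ (gammaHom X) (isIso_gammaHom X)
  monoidal X Y := gammaHom_tensor X Y
  naturality f := gammaHom_naturality f

/-- The multiplication of `H` in the center. -/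
noncomputable def adMul :
    HadCenter H (adHalfBraiding H) ⊗ HadCenter H (adHalfBraiding H) ⟶
      HadCenter H (adHalfBraiding H) where
  f := mkHom (M := Had H ⊗ Had H) (N := Had H) μ[H] (mul_hom_Had H)
  comm X := Mod.hom_ext _ _
    (gamma_mul (act X) (mul_act (X ⊗ regMod H)))

/-- The unit of `H` in the center. -/
noncomputable def adOne : 𝟙_ (Center (Mod V H)) ⟶ HadCenter H (adHalfBraiding H) where
  f := mkHom (M := 𝟙_ (Mod V H)) (N := Had H) η[H] (one_hom_Had H)
  comm X := Mod.hom_ext _ _ (gamma_one (act X) (one_act (X ⊗ regMod H)))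

/-- The adjoint algebra in the center. -/
noncomputable abbrev adMonObj : MonObj (HadCenter H (adHalfBraiding H)) where
  one := adOne H
  mul := adMul H
  one_mul := Center.ext _ _ (Mod.hom_ext _ _ (MonObj.one_mul H))
  mul_one := Center.ext _ _ (Mod.hom_ext _ _ (MonObj.mul_one H))
  mul_assoc := Center.ext _ _ (Mod.hom_ext _ _ (MonObj.mul_assoc H))

variable {H}

lemma halfBraiding_adPiHom_iff {A X M : Mod V H} (b : A ⊗ X ⟶ X ⊗ A) (p : A ⟶ uHom M M)
    (q : A ⟶ uHom (X ⊗ M) (X ⊗ M)) :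
    b ≫ X ◁ p ≫ uA X M M = q ▷ X ≫ uB X M (X ⊗ M) ↔
      b.hom ▷ M.X ≫ (α_ X.X A.X M.X).hom ≫ X.X ◁ actOf p =
        (α_ A.X X.X M.X).hom ≫ actOf q := by
  rw [halfBraiding_iff]
  exact ⟨fun h => congrArg Mod.Hom.hom h, fun h => Mod.hom_ext _ _ h⟩

lemma mul_adPiHom_iff {A M : Mod V H} (m : A ⊗ A ⟶ A) (p : A ⟶ uHom M M) :
    m ≫ p = (p ⊗ₘ p) ≫ uComp M M M ↔
      m.hom ▷ M.X ≫ actOf p = (α_ A.X A.X M.X).hom ≫ A.X ◁ actOf p ≫ actOf p := by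
  rw [mul_iff]
  exact ⟨fun h => congrArg Mod.Hom.hom h, fun h => Mod.hom_ext _ _ h⟩

lemma one_adPiHom_iff {A M : Mod V H} (e : 𝟙_ (Mod V H) ⟶ A) (p : A ⟶ uHom M M) :
    e ≫ p = homEquiv (𝟙_ (Mod V H)) M M (λ_ M).hom ↔
      e.hom ▷ M.X ≫ actOf p = (λ_ M.X).hom := by
  rw [one_iff]
  exact ⟨fun h => congrArg Mod.Hom.hom h, fun h => Mod.hom_ext _ _ h⟩

lemma isAdjointAlgebra_adMonObj :
    @IsAdjointAlgebra _ _ _ _ _ _ _ (centralFunctor H) _ _ (HadCenter H (adHalfBraiding H))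
      (adMonObj H) adPiHom :=
  letI := adMonObj H
  { isRelativeEnd := isRelativeEnd_adPiHom
    relativeCenter := fun W => Mod.hom_ext _ _ (by
      refine (congrArg (fun t : H ⊗ W ⟶ W ⊗ H => t ≫ (β_ H W).inv)
        (gammaHom_triv_hom (H := H) W)).trans ?_
      exact (β_ H W).hom_inv_id)
    halfBraiding := fun X M => by
      refine (halfBraiding_adPiHom_iff (gammaHom X) _ _).2 ?_
      rw [actOf_adPiHom, actOf_adPiHom]
      change gamma (act X) ▷ M.X ≫ (α_ X.X H M.X).hom ≫ X.X ◁ act M =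
        (α_ H X.X M.X).hom ≫ tAct (act X) (act M)
      rw [tAct_eq, Iso.hom_inv_id_assoc]
    mul := fun M => by
      refine (mul_adPiHom_iff (adMul H).f _).2 ?_
      rw [actOf_adPiHom]
      exact mul_act M
    one := fun M => by
      refine (one_adPiHom_iff (adOne H).f _).2 ?_
      rw [actOf_adPiHom]
      exact one_act M }

end Algebra

/-! ### Uniqueness of relative ends -/

section Uniqueness

universe v₁ u₁ v₂ u₂
variable {V : Type u} [Category.{v} V] [MonoidalCategory V] [RightRigidCategory V]
variable {C : Type u₁} [Category.{v₁} C] [MonoidalCategory C]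
variable {G : V ⥤ Center C} [G.Monoidal] {A : Type u₂} [Category.{v₂} A]
variable {S : Cᵒᵖ ⥤ C ⥤ A} {β : ∀ (W : V) (M N : C),
  (S.obj (.op M)).obj (vAct G W N) ⟶ (S.obj (.op (vAct G Wᘁ M))).obj N}

lemma IsRelativeCone.precomp {E E' : A} {π : ∀ M : C, E ⟶ (S.obj (.op M)).obj M}
    (h : IsRelativeCone G S β E π) (f : E' ⟶ E) :
    IsRelativeCone G S β E' (fun M => f ≫ π M) where
  dinatural g := by rw [Category.assoc, Category.assoc, h.dinatural]
  relative W M := by rw [Category.assoc, Category.assoc, h.relative]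

lemma IsRelativeEnd.hom_ext {E E' : A} {π : ∀ M : C, E ⟶ (S.obj (.op M)).obj M}
    (h : IsRelativeEnd G S β E π) {f g : E' ⟶ E} (hfg : ∀ M, f ≫ π M = g ≫ π M) : f = g :=
  (h.universal E' (fun M => f ≫ π M) (h.toIsRelativeCone.precomp f)).unique (fun _ => rfl)
    (fun M => (hfg M).symm)

/-- Two relative ends are isomorphic. -/
lemma IsRelativeEnd.exists_iso {E E' : A} {π : ∀ M : C, E ⟶ (S.obj (.op M)).obj M}
    {ξ : ∀ M : C, E' ⟶ (S.obj (.op M)).obj M} (h : IsRelativeEnd G S β E π)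
    (h' : IsRelativeEnd G S β E' ξ) : ∃ e : E' ≅ E, ∀ M, e.hom ≫ π M = ξ M := by
  obtain ⟨e, he, -⟩ := h.universal E' ξ h'.toIsRelativeCone
  obtain ⟨f, hf, -⟩ := h'.universal E π h.toIsRelativeCone
  exact ⟨⟨e, f, h'.hom_ext fun M => by rw [Category.assoc, hf, he, Category.id_comp],
    h.hom_ext fun M => by rw [Category.assoc, he, hf, Category.id_comp]⟩, he⟩

end Uniqueness

/-! ### Comparison with an arbitrary realization -/

section Comparison

variable {V : Type u} [Category.{v} V] [MonoidalCategory V] [BraidedCategory V]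
variable [RightRigidCategory V] {H : V} [HopfObj H]

/-- Both half-braidings are recovered from the action on `X ⊗ H` with `H` regular, by `ext_mul`, and
`e` matches these actions. -/
lemma comparison_comm {A : Center (Mod V H)} [MonObj A] {ξ : ∀ X : Mod V H, A.1 ⟶ uHom X X}
    (hA : IsAdjointAlgebra (centralFunctor H) A ξ) {e : A.1 ⟶ Had H}
    (he : ∀ M, e ≫ adPiHom M = ξ M) (X : Mod V H) :
    e ▷ X ≫ gammaHom X = (A.2.β X).hom ≫ X ◁ e := by
  have he' (M : Mod V H) : e.hom ▷ M.X ≫ act M = actOf (ξ M) := by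
    rw [← he, actOf_precomp, actOf_adPiHom]
  have hb := (halfBraiding_adPiHom_iff _ _ _).1 (hA.halfBraiding X (regMod H))
  refine Mod.hom_ext _ _ (ext_mul (H := H) ?_)
  let f : A.1.X ⟶ H := e.hom
  let b : A.1.X ⊗ X.X ⟶ X.X ⊗ A.1.X := (A.2.β X).hom.hom
  change (f ▷ X.X ≫ gamma (act X)) ▷ H ≫ (α_ X.X H H).hom ≫ X.X ◁ μ[H] =
    (b ≫ X.X ◁ f) ▷ H ≫ (α_ X.X H H).hom ≫ X.X ◁ μ[H]
  have h1 : f ▷ H ≫ μ[H] = actOf (ξ (regMod H)) := he' (regMod H)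
  have h2 : f ▷ (X.X ⊗ H) ≫ tAct (act X) μ[H] = actOf (ξ (X ⊗ regMod H)) := he' (X ⊗ regMod H)
  have h3 : b ▷ H ≫ (α_ X.X A.1.X H).hom ≫ X.X ◁ (f ▷ H ≫ μ[H]) =
      (α_ A.1.X X.X H).hom ≫ f ▷ (X.X ⊗ H) ≫ tAct (act X) μ[H] := by
    rw [h1, h2]; exact hb
  calc _ = (α_ A.1.X X.X H).hom ≫ f ▷ (X.X ⊗ H) ≫ tAct (act X) μ[H] := by
        rw [tAct_eq]; simp
    _ = _ := by
        rw [← h3]; simp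

lemma comparison {A : Center (Mod V H)} [MonObj A] {ξ : ∀ X : Mod V H, A.1 ⟶ uHom X X}
    (hA : IsAdjointAlgebra (centralFunctor H) A ξ) :
    letI := adMonObj H
    ∃ e : A ≅ HadCenter H (adHalfBraiding H),
      IsMonHom e.hom ∧ ∀ X : Mod V H, e.hom.f ≫ adPiHom X = ξ X := by
  let := adMonObj H
  have hH := isAdjointAlgebra_adMonObj (H := H)
  obtain ⟨e, he⟩ := hH.isRelativeEnd.exists_iso hA.isRelativeEnd
  let f : A ⟶ HadCenter H (adHalfBraiding H) := ⟨e.hom, comparison_comm hA he⟩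
  have : IsIso f.f := e.isIso_hom
  -- Morphisms into the adjoint module are separated by `adPiHom`, and after composing with it the
  -- unit and multiplication of both algebras satisfy the same defining equations.
  refine ⟨Center.isoMk f, ⟨Center.ext _ _ (hom_ext_adPiHom fun M => ?_),
    Center.ext _ _ (hom_ext_adPiHom fun M => ?_)⟩, he⟩
  · change (η[A].f ≫ e.hom) ≫ adPiHom M = (adOne H).f ≫ adPiHom M
    exact (Category.assoc _ _ _).trans ((congrArg (η[A].f ≫ ·) (he M)).trans
      ((hA.one M).trans (hH.one M).symm))
  · change (μ[A].f ≫ e.hom) ≫ adPiHom M = ((e.hom ⊗ₘ e.hom) ≫ (adMul H).f) ≫ adPiHom M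
    have h1 : (adMul H).f ≫ adPiHom M = (adPiHom M ⊗ₘ adPiHom M) ≫ uComp M M M := hH.mul M
    have h2 : (e.hom ⊗ₘ e.hom) ≫ (adPiHom M ⊗ₘ adPiHom M) = ξ M ⊗ₘ ξ M := by
      rw [tensorHom_comp_tensorHom]
      exact congrArg₂ (· ⊗ₘ ·) (he M) (he M)
    refine (Category.assoc _ _ _).trans ((congrArg (μ[A].f ≫ ·) (he M)).trans
      ((hA.mul M).trans ?_))
    refine Eq.trans ?_ (Category.assoc _ _ _).symm
    refine Eq.trans ?_ (congrArg ((e.hom ⊗ₘ e.hom) ≫ ·) h1).symm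
    exact (congrArg (· ≫ uComp M M M) h2).symm.trans (Category.assoc _ _ _)

end Comparison

end BraidedAdjoint

theorem mainTheorem12 {V : Type u} [Category.{v} V] [MonoidalCategory V] [BraidedCategory V]
    [RightRigidCategory V] (H : V) [HopfObj H] :
    ∃ π : ∀ X : Mod V H, Had H ⟶ uHom X X,
      (∀ X : Mod V H, (π X).hom = adPi X) ∧
      IsRelativeCone (centralFunctor H) (uHomFunctor (Mod V H)) (uPrebalancing (centralFunctor H))
        (Had H) π ∧
      ∃ b : HalfBraiding (Had H), (∀ X : Mod V H, (b.β X).hom.hom = adBraiding X) ∧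
        ∃ m : MonObj (HadCenter H b),
          m.mul.f.hom = μ[H] ∧ m.one.f.hom = η[H] ∧
          IsAdjointAlgebra (centralFunctor H) (HadCenter H b) π ∧
          ∀ (A : Center (Mod V H)) [MonObj A] (ξ : ∀ X : Mod V H, A.1 ⟶ uHom X X),
            IsAdjointAlgebra (centralFunctor H) A ξ →
            ∃ e : A ≅ HadCenter H b, IsMonHom e.hom ∧ ∀ X : Mod V H, e.hom.f ≫ π X = ξ X :=
  ⟨adPiHom, adPiHom_hom, isRelativeCone_adPiHom, adHalfBraiding H, fun _ => rfl, adMonObj H,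
    rfl, rfl, isAdjointAlgebra_adMonObj, fun _ _ _ hA => comparison hA⟩
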